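/- Let $\mathbb F_q$ be a finite field and $A=\mathbb F_q[T]$. For an irreducible polynomial $f\in A[x]$ with leading coefficient in $A^\times=\mathbb F_q^\times$ (so that $R=A[x]/(f)$ is an $A$-order in its fraction field) and a nonzero prime ideal $\mathfrak p=(P)$ of $A$, let $R_{\mathfrak p}=\varprojlim_n R/\mathfrak p^nR$ and let $K_{\mathfrak p}$ be the total ring of fractions of $R_{\mathfrak p}$. The ideal class monoid $\mathrm{ICM}(R_{\mathfrak p})$ is the monoid, under multiplication, of the fractional $R_{\mathfrak p}$-ideals in $K_{\mathfrak p}$ that contain a unit of $K_{\mathfrak p}$, modulo the relation $I\sim J\iff I=xJ$ for some $x\in K_{\mathfrak p}^\times$. Then $\mathrm{ICM}(R_{\mathfrak p})$ is finite and can be computed: for each fixed $\mathbb F_q$ there is an algorithm (a partial recursive function) which, given the coefficients of any such $f$ and of any irreducible $P\in A$, halts and returns 1. a finite list of ideals $I_1,\dots,I_n$ of $R$, each given by a finite list of generators (polynomials in $A[x]$ taken modulo $f$), such that every class of $\mathrm{ICM}(R_{\mathfrak p})$ is the class of $I_iR_{\mathfrak p}$ for exactly one $i$; and 2. the multiplication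 table of $\mathrm{ICM}(R_{\mathfrak p})$ with respect to this list, i.e. for all $i,j$ the index $m$ such that $I_iI_jR_{\mathfrak p}\sim I_mR_{\mathfrak p}$. -/

import Mathlib

open scoped Polynomial

noncomputable section

namespace IdealClasses

/-- The monoid of full fractional ideals of a commutative ring `R`: the fractional ideals in the
total ring of fractions of `R` that contain a unit of it. For a domain these are the nonzero
fractional ideals; for an order in a product of fields they are the fractional ideals that are
full lattices. -/
def fullFractionalIdeals (R : Type*) [CommRing R] :
    Submonoid (FractionalIdeal (nonZeroDivisors R) (FractionRing R)) where
  carrier := {I | ∃ x ∈ I, IsUnit x}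
  one_mem' := ⟨1, FractionalIdeal.one_mem_one _, isUnit_one⟩
  mul_mem' := by
    rintro I J ⟨x, hx, ux⟩ ⟨y, hy, uy⟩
    exact ⟨x * y, FractionalIdeal.mul_mem_mul hx hy, ux.mul uy⟩

/-- Two full fractional ideals are equivalent if they differ by a principal factor `x R`, with
`x` a unit of the total ring of fractions. -/
def principalCon (R : Type*) [CommRing R] : Con (fullFractionalIdeals R) where
  r I J := ∃ x : (FractionRing R)ˣ,
    (I : FractionalIdeal (nonZeroDivisors R) (FractionRing R)) =
      FractionalIdeal.spanSingleton (nonZeroDivisors R) (x : FractionRing R) * J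
  iseqv := by
    refine ⟨fun I => ⟨1, by simp⟩, ?_, ?_⟩
    · rintro I J ⟨x, hx⟩
      refine ⟨x⁻¹, ?_⟩
      rw [hx, ← mul_assoc, FractionalIdeal.spanSingleton_mul_spanSingleton]
      simp
    · rintro I J L ⟨x, hx⟩ ⟨y, hy⟩
      refine ⟨x * y, ?_⟩
      rw [hx, hy, ← mul_assoc, FractionalIdeal.spanSingleton_mul_spanSingleton]
      simp
  mul' := by
    rintro I J L M ⟨x, hx⟩ ⟨y, hy⟩
    refine ⟨x * y, ?_⟩
    rw [Submonoid.coe_mul, Submonoid.coe_mul, hx, hy, Units.val_mul,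
      ← FractionalIdeal.spanSingleton_mul_spanSingleton, mul_mul_mul_comm]

/-- The ideal class monoid: full fractional ideals modulo principal ones. -/
abbrev ICM (R : Type*) [CommRing R] := (principalCon R).Quotient

variable {k : Type*} [Field k]

/-- The completion `R_P` of `R = k[T][x]/(f)` at the prime `(P)` of `k[T]`, that is, the inverse
limit of the rings `R / P ^ n R`. -/
abbrev CompletedOrder (f : k[X][X]) (P : k[X]) :=
  AdicCompletion ((Ideal.span {P}).map (algebraMap k[X] (AdjoinRoot f))) (AdjoinRoot f)

/-- The ideal of `R_P` generated by the residue classes in `R = k[T][x]/(f)` of the members of a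
list of polynomials, i.e. the completion of the ideal of `R` which they generate. -/
def completedIdeal (f : k[X][X]) (P : k[X]) (gens : List k[X][X]) : Ideal (CompletedOrder f P) :=
  Ideal.span {y | ∃ g ∈ gens,
    y = algebraMap (AdjoinRoot f) (CompletedOrder f P) (AdjoinRoot.mk f g)}

/-- The list `gens` generates a full ideal of `R_P`, and `c` is the class of that ideal. -/
def Represents (f : k[X][X]) (P : k[X]) (gens : List k[X][X]) (c : ICM (CompletedOrder f P)) :
    Prop :=
  ∃ I : fullFractionalIdeals (CompletedOrder f P),
    (I : FractionalIdeal (nonZeroDivisors (CompletedOrder f P))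
      (FractionRing (CompletedOrder f P))) = (completedIdeal f P gens : FractionalIdeal _ _) ∧
    (I : ICM (CompletedOrder f P)) = c

/-- The polynomial with a given list of coefficients, constant coefficient first. -/
def ofCoeffs {S : Type*} [Semiring S] : List S → S[X]
  | [] => 0
  | a :: l => Polynomial.C a + Polynomial.X * ofCoeffs l

/-- The polynomial over `k[T]` with a given list of coefficients, each of them given by its own
list of coefficients. -/
def ofCoeffs₂ (l : List (List k)) : k[X][X] := ofCoeffs (l.map ofCoeffs)

/-- The finite data `(reps, table)` describe the monoid `ICM R_P`: the members of `reps` are lists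
of generators of ideals that represent each class exactly once, and the entry of `table` in row `i`
and column `j` is the index of the product of the `i`-th and the `j`-th class. -/
def DescribesICM (f : k[X][X]) (P : k[X])
    (out : List (List (List (List k))) × List (List ℕ)) : Prop :=
  ∃ e : Fin out.1.length ≃ ICM (CompletedOrder f P),
    (∀ i, Represents f P ((out.1.get i).map ofCoeffs₂) (e i)) ∧
    ∀ i j : Fin out.1.length, ∃ m : Fin out.1.length,
      (∃ row, out.2[(i : ℕ)]? = some row ∧ row[(j : ℕ)]? = some (m : ℕ)) ∧ e i * e j = e m

end IdealClasses

end

/-! Write `R = k[T][x]/(f)`. Its completion `R_P` is `P`-adically complete, `P` is a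
non-zero-divisor in it and `R_P / P` is finite.

The class monoid is finite because `k` is perfect: after a change of variables `T ↦ x`,
`x ↦ T + x ^ r`, if necessary, the curve `f = 0` has a separable finite projection, so that the
normalization of `R` is a Dedekind domain, finite over `R`. Multiplying by a conductor shows that,
for some fixed `t`, every full ideal of `R_P` is equivalent to one containing `P ^ t`.

Two ideals that contain `P ^ m` are equivalent if and only if they look equivalent modulo
`P ^ (2 * m + 1)`, since `1 + P * a` is always a unit. Hence the finite ring `R / P ^ N` decides
everything as soon as `N` is large compared to `t`.

The exponent `t` need not be computed. The algorithm searches for a finite model of `R / P ^ N`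
together with representatives and a multiplication table. That the representatives are exhaustive
can be seen inside the model: every full ideal is equivalent to one reached from the unit ideal by
steps to neighbours `P L ≤ J ≤ L`, so it suffices that every neighbour of a representative is
equivalent to a representative. Such a certificate proves its own correctness, whatever `t` is, and
the finiteness of the class monoid ensures that one exists. -/

namespace IdealClasses

open Polynomial

section AdicallyComplete

variable {S : Type*} [CommRing S] {p : S}

theorem smodEq_span_singleton_pow_smul_top_iff {M : Type*} [AddCommGroup M] [Module S M] {n : ℕ}
    {x y : M} :
    x ≡ y [SMOD (Ideal.span {p} ^ n • ⊤ : Submodule S M)] ↔ ∃ z, p ^ n • z = x - y := by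
  simp only [SModEq.sub_mem, Ideal.span_singleton_pow, Submodule.ideal_span_singleton_smul,
    Submodule.mem_smul_pointwise_iff_exists, Submodule.mem_top, true_and]

theorem isPrecomplete_pi (ι : Type*) [IsPrecomplete (Ideal.span {p}) S] :
    IsPrecomplete (Ideal.span {p}) (ι → S) := by
  refine ⟨fun f hf => ?_⟩
  simp only [smodEq_span_singleton_pow_smul_top_iff] at hf ⊢
  have coordinate (i : ι) : ∃ L, ∀ n, ∃ z, p ^ n • z = f n i - L := by
    simp only [← smodEq_span_singleton_pow_smul_top_iff]
    refine IsPrecomplete.prec inferInstance fun {m n} hmn => ?_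
    obtain ⟨z, hz⟩ := hf hmn
    exact smodEq_span_singleton_pow_smul_top_iff.2 ⟨z i, congrFun hz i⟩
  choose L z hz using coordinate
  exact ⟨L, fun n => ⟨fun i => z i n, funext fun i => hz i n⟩⟩

theorem isHausdorff_submodule {M : Type*} [AddCommGroup M] [Module S M]
    [IsHausdorff (Ideal.span {p}) M] (N : Submodule S M) : IsHausdorff (Ideal.span {p}) N := by
  refine ⟨fun x hx => Subtype.ext (IsHausdorff.haus ‹_› (x : M) fun n => ?_)⟩
  obtain ⟨z, hz⟩ := smodEq_span_singleton_pow_smul_top_iff.1 (hx n)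
  exact smodEq_span_singleton_pow_smul_top_iff.2 ⟨z, by simpa using congrArg N.subtype hz⟩

theorem span_eq_of_le_span_sup_mul [IsAdicComplete (Ideal.span {p}) S] {I : Ideal S}
    {s : Finset S} (hs : Ideal.span s ≤ I) (h : I ≤ Ideal.span s ⊔ Ideal.span {p} * I) :
    Ideal.span s = I := by
  refine le_antisymm hs fun x hx => ?_
  have := isPrecomplete_pi (p := p) s
  have := isHausdorff_submodule (p := p) I
  let g : (s → S) →ₗ[S] I :=
    Fintype.linearCombination S fun a : s => (⟨a, hs (Ideal.subset_span a.2)⟩ : I)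
  have hg (c : s → S) : (g c : S) = ∑ a, c a * a := by
    simp [g, Fintype.linearCombination_apply]
  have mem_span_iff (y : S) : y ∈ Ideal.span (s : Set S) ↔ ∃ c, (g c : S) = y := by
    simp only [hg, Ideal.span, Submodule.mem_span_finset', smul_eq_mul, eq_comm]
  have surjective_mod : Function.Surjective
      ((Ideal.span {p} • (⊤ : Submodule S I)).mkQ ∘ₗ g) := by
    intro q
    obtain ⟨y, rfl⟩ := Submodule.mkQ_surjective _ q
    obtain ⟨u, hu, v, hv, huv⟩ := Submodule.mem_sup.1 (h y.2)
    obtain ⟨c, rfl⟩ := (mem_span_iff u).1 hu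
    obtain ⟨w, hw, rfl⟩ := Ideal.mem_span_singleton_mul.1 hv
    refine ⟨c, ((Submodule.Quotient.eq _).2 ?_).symm⟩
    have : y - g c = p • (⟨w, hw⟩ : I) := Subtype.ext (by simp [← huv])
    rw [this]
    exact Submodule.smul_mem_smul (Ideal.mem_span_singleton_self p) trivial
  obtain ⟨c, hc⟩ := surjective_of_mkQ_comp_surjective surjective_mod ⟨x, hx⟩
  exact (mem_span_iff x).2 ⟨c, congrArg Subtype.val hc⟩

theorem exists_finset_span_le_sup_inf [IsNoetherianRing (S ⧸ Ideal.span {p})] (I : Ideal S) :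
    ∃ s : Finset S, Ideal.span s ≤ I ∧ I ≤ Ideal.span s ⊔ Ideal.span {p} ⊓ I := by
  classical
  set f := Ideal.Quotient.mk (Ideal.span {p})
  obtain ⟨t, htI, hspan⟩ := (Submodule.fg_span_iff_fg_span_finset_subset (f '' I)).1
    (IsNoetherian.noetherian (I.map f))
  obtain ⟨s, hsI, rfl⟩ := Finset.subset_set_image_iff.1 htI
  have hs : Ideal.span (s : Set S) ≤ I := Ideal.span_le.2 hsI
  refine ⟨s, hs, fun x hx => ?_⟩
  have hx' : x ∈ Ideal.span (s : Set S) ⊔ Ideal.span {p} := by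
    rw [← Ideal.mk_ker (I := Ideal.span {p}), ← Ideal.comap_map_of_surjective' f
      Ideal.Quotient.mk_surjective, Ideal.mem_comap, Ideal.map_span, ← Finset.coe_image]
    exact hspan.le (Ideal.mem_map_of_mem f hx)
  obtain ⟨u, hu, v, hv, rfl⟩ := Submodule.mem_sup.1 hx'
  exact add_mem (Ideal.mem_sup_left hu)
    (Ideal.mem_sup_right ⟨hv, (I.add_mem_iff_right (hs hu)).1 hx⟩)

/-- Cohen's theorem reduces this to prime ideals `q`: if `p ∉ q` then `q ∩ (p) = p q`, so that
finitely many generators modulo `p` generate by completeness. -/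
theorem isNoetherianRing_of_isAdicComplete [IsAdicComplete (Ideal.span {p}) S]
    [IsNoetherianRing (S ⧸ Ideal.span {p})] : IsNoetherianRing S := by
  refine IsNoetherianRing.of_prime fun q hq => ?_
  obtain ⟨s, hsq, hqs⟩ := exists_finset_span_le_sup_inf (p := p) q
  by_cases hp : p ∈ q
  · rw [inf_eq_left.2 ((Ideal.span_singleton_le_iff_mem q).2 hp)] at hqs
    have := le_antisymm hqs (sup_le hsq ((Ideal.span_singleton_le_iff_mem q).2 hp))
    rw [this]
    exact Submodule.FG.sup ⟨s, rfl⟩ (Submodule.fg_span_singleton p)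
  · refine ⟨s, span_eq_of_le_span_sup_mul (p := p) hsq (hqs.trans (sup_le_sup le_rfl ?_))⟩
    rintro x ⟨hxp, hxq⟩
    obtain ⟨y, rfl⟩ := Ideal.mem_span_singleton.1 hxp
    exact Ideal.mul_mem_mul (Ideal.mem_span_singleton_self p) ((hq.mem_or_mem hxq).resolve_left hp)

theorem mem_minimalPrimes_span_singleton_of_isMaximal [Ring.KrullDimLE 0 (S ⧸ Ideal.span {p})]
    (hp : p ∈ Ideal.jacobson (⊥ : Ideal S)) {m : Ideal S} (hm : m.IsMaximal) :
    m ∈ (Ideal.span {p}).minimalPrimes := by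
  have hpm : Ideal.span {p} ≤ m :=
    (Ideal.span_singleton_le_iff_mem m).2 (Ideal.mem_sInf.1 hp ⟨bot_le, hm⟩)
  have := hm.isPrime
  have hprime : (m.map (Ideal.Quotient.mk (Ideal.span {p}))).IsPrime :=
    Ideal.map_isPrime_of_surjective Ideal.Quotient.mk_surjective (by rwa [Ideal.mk_ker])
  rw [Ideal.minimalPrimes_eq_comap]
  exact ⟨_, Ring.KrullDimLE.mem_minimalPrimes_iff.2 ⟨hprime, bot_le⟩, Ideal.comap_map_mk hpm⟩

/-- By Krull's principal ideal theorem all maximal ideals have height at most one, so that a prime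
ideal that contains a non-zero-divisor is maximal. -/
theorem exists_dvd_pow_of_mem_jacobson_bot [IsNoetherianRing S]
    [Ring.KrullDimLE 0 (S ⧸ Ideal.span {p})] (hp : p ∈ Ideal.jacobson (⊥ : Ideal S)) {s : S}
    (hs : s ∈ nonZeroDivisors S) : ∃ n, s ∣ p ^ n := by
  suffices p ∈ (Ideal.span {s}).radical by
    simpa only [Ideal.mem_radical_iff, Ideal.mem_span_singleton] using this
  rw [Ideal.radical_eq_sInf, Ideal.mem_sInf]
  rintro q ⟨hsq, hq⟩
  obtain ⟨m, hm, hqm⟩ := Ideal.exists_le_maximal q hq.ne_top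
  have hm_height : m.height ≤ 1 :=
    (Ideal.span {p}).height_le_one_of_isPrincipal_of_mem_minimalPrimes m
      (mem_minimalPrimes_span_singleton_of_isMaximal hp hm)
  rcases hqm.eq_or_lt with rfl | hlt
  · exact Ideal.mem_sInf.1 hp ⟨bot_le, hm⟩
  · have hq_height : q.height < 1 := (Ideal.height_strict_mono_of_isPrime hlt).trans_le hm_height
    have hq_minimal := Ideal.height_eq_zero_iff.1 (Order.lt_one_iff.1 hq_height)
    exact absurd hs (notMem_nonZeroDivisors_of_mem_mem_minimalPrimes
      ((Ideal.span_singleton_le_iff_mem q).1 hsq) hq_minimal)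

end AdicallyComplete

section FinitelyComplete

variable {S : Type*} [CommRing S] {p : S}

/-- A commutative ring `S` is *finitely complete* at `p` if `p` is a non-zero-divisor, `S` is
`p`-adically complete and `S / p` is finite. The completions of an order at a nonzero prime are of
this kind, and everything about their ideal classes is deduced from these three properties. -/
structure FinitelyComplete (p : S) : Prop where
  mem_nonZeroDivisors : p ∈ nonZeroDivisors S
  finite_quotient : Finite (S ⧸ Ideal.span {p})
  isAdicComplete : IsAdicComplete (Ideal.span {p}) S

namespace FinitelyComplete

theorem pow_mem (h : FinitelyComplete p) (n : ℕ) : p ^ n ∈ nonZeroDivisors S :=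
  _root_.pow_mem h.mem_nonZeroDivisors n

theorem isNoetherianRing (h : FinitelyComplete p) : IsNoetherianRing S := by
  have := h.finite_quotient
  have := h.isAdicComplete
  exact isNoetherianRing_of_isAdicComplete (p := p)

theorem finite_quotient_pow (h : FinitelyComplete p) (n : ℕ) :
    Finite (S ⧸ Ideal.span {p ^ n}) := by
  have := h.finite_quotient
  rw [← Ideal.span_singleton_pow]
  exact Ideal.finite_quotient_pow (Submodule.fg_span_singleton p) n

theorem mem_jacobson_bot (h : FinitelyComplete p) : p ∈ Ideal.jacobson (⊥ : Ideal S) := by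
  have := h.isAdicComplete
  exact IsAdicComplete.le_jacobson_bot (Ideal.span {p}) (Ideal.mem_span_singleton_self p)

theorem isUnit_one_add_mul (h : FinitelyComplete p) (a : S) : IsUnit (1 + p * a) :=
  add_comm (p * a) 1 ▸ Ideal.mem_jacobson_bot.1 h.mem_jacobson_bot a

theorem exists_dvd_pow (h : FinitelyComplete p) {s : S} (hs : s ∈ nonZeroDivisors S) :
    ∃ n, s ∣ p ^ n := by
  have := h.finite_quotient
  have := h.isNoetherianRing
  exact exists_dvd_pow_of_mem_jacobson_bot h.mem_jacobson_bot hs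

theorem exists_mem_nonZeroDivisors (h : FinitelyComplete p) {I : Ideal S} {n : ℕ}
    (hI : p ^ n ∈ I) : ∃ x ∈ I, x ∈ nonZeroDivisors S :=
  ⟨_, hI, h.pow_mem n⟩

theorem exists_pow_mem (h : FinitelyComplete p) {I : Ideal S}
    (hI : ∃ x ∈ I, x ∈ nonZeroDivisors S) : ∃ n, p ^ n ∈ I := by
  obtain ⟨x, hx, hx'⟩ := hI
  obtain ⟨n, hn⟩ := h.exists_dvd_pow hx'
  exact ⟨n, I.mem_of_dvd hn hx⟩

end FinitelyComplete

end FinitelyComplete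

section SameClass

variable {S : Type*} [CommRing S] {I J L : Ideal S}

/-- Two ideals of `S` are in the same class if `a I = b J` for non-zero-divisors `a` and `b`. For
ideals that contain a non-zero-divisor this is equality in `ICM S`. -/
def SameClass (I J : Ideal S) : Prop :=
  ∃ a ∈ nonZeroDivisors S, ∃ b ∈ nonZeroDivisors S, Ideal.span {a} * I = Ideal.span {b} * J

namespace SameClass

theorem symm : SameClass I J → SameClass J I :=
  fun ⟨a, ha, b, hb, h⟩ => ⟨b, hb, a, ha, h.symm⟩

theorem trans : SameClass I J → SameClass J L → SameClass I L := by
  rintro ⟨a, ha, b, hb, h⟩ ⟨c, hc, d, hd, h'⟩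
  refine ⟨c * a, mul_mem hc ha, b * d, mul_mem hb hd, ?_⟩
  rw [← Ideal.span_singleton_mul_span_singleton, mul_assoc, h, mul_left_comm, h', ← mul_assoc,
    Ideal.span_singleton_mul_span_singleton]

end SameClass

/-- An ideal that contains a non-zero-divisor, as a full fractional ideal. -/
def fullOfIdeal (I : Ideal S) (hI : ∃ x ∈ I, x ∈ nonZeroDivisors S) : fullFractionalIdeals S :=
  ⟨(I : FractionalIdeal (nonZeroDivisors S) (FractionRing S)), by
    obtain ⟨x, hx, hx'⟩ := hI
    exact ⟨algebraMap S _ x, FractionalIdeal.mem_coeIdeal_of_mem _ hx,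
      IsLocalization.map_units (FractionRing S) ⟨x, hx'⟩⟩⟩

/-- The class in `ICM S` of an ideal that contains a non-zero-divisor. -/
def classOfIdeal (I : Ideal S) (hI : ∃ x ∈ I, x ∈ nonZeroDivisors S) : ICM S :=
  (fullOfIdeal I hI : ICM S)

theorem span_singleton_mul_eq_iff_spanSingleton_mul_eq {K : Type*} [CommRing K] [Algebra S K]
    [IsFractionRing S K] (a b : S) :
    Ideal.span {a} * I = Ideal.span {b} * J ↔
      FractionalIdeal.spanSingleton (nonZeroDivisors S) (algebraMap S K a) *
          (I : FractionalIdeal (nonZeroDivisors S) K) =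
        FractionalIdeal.spanSingleton (nonZeroDivisors S) (algebraMap S K b) *
          (J : FractionalIdeal (nonZeroDivisors S) K) := by
  rw [← FractionalIdeal.coeIdeal_span_singleton, ← FractionalIdeal.coeIdeal_span_singleton,
    ← FractionalIdeal.coeIdeal_mul, ← FractionalIdeal.coeIdeal_mul,
    FractionalIdeal.coeIdeal_inj' le_rfl]

theorem sameClass_iff_exists_units {K : Type*} [CommRing K] [Algebra S K] [IsFractionRing S K] :
    SameClass I J ↔ ∃ x : Kˣ, (I : FractionalIdeal (nonZeroDivisors S) K) =
      FractionalIdeal.spanSingleton (nonZeroDivisors S) (x : K) *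
        (J : FractionalIdeal (nonZeroDivisors S) K) := by
  constructor
  · rintro ⟨a, ha, b, hb, hab⟩
    have hua := IsLocalization.map_units K (⟨a, ha⟩ : nonZeroDivisors S)
    have hub := IsLocalization.map_units K (⟨b, hb⟩ : nonZeroDivisors S)
    refine ⟨hua.unit⁻¹ * hub.unit, ?_⟩
    rw [Units.val_mul, ← FractionalIdeal.spanSingleton_mul_spanSingleton, mul_assoc,
      IsUnit.unit_spec, ← (span_singleton_mul_eq_iff_spanSingleton_mul_eq a b).1 hab, ← mul_assoc,
      FractionalIdeal.spanSingleton_mul_spanSingleton]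
    simp
  · rintro ⟨x, hx⟩
    obtain ⟨⟨b, a⟩, hab⟩ := IsLocalization.surj (nonZeroDivisors S) (x : K)
    have hb : IsUnit (algebraMap S K b) := hab ▸ x.isUnit.mul (IsLocalization.map_units K a)
    refine ⟨a, a.2, b, mem_nonZeroDivisors_of_injective (IsFractionRing.injective S K)
      hb.mem_nonZeroDivisors, (span_singleton_mul_eq_iff_spanSingleton_mul_eq (K := K) _ _).2 ?_⟩
    rw [hx, ← mul_assoc, FractionalIdeal.spanSingleton_mul_spanSingleton, mul_comm _ (x : K), hab]

theorem classOfIdeal_eq_iff {hI : ∃ x ∈ I, x ∈ nonZeroDivisors S}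
    {hJ : ∃ x ∈ J, x ∈ nonZeroDivisors S} :
    classOfIdeal I hI = classOfIdeal J hJ ↔ SameClass I J :=
  (Con.eq _).trans sameClass_iff_exists_units.symm

theorem classOfIdeal_mul (hI : ∃ x ∈ I, x ∈ nonZeroDivisors S)
    (hJ : ∃ x ∈ J, x ∈ nonZeroDivisors S) (hIJ : ∃ x ∈ I * J, x ∈ nonZeroDivisors S) :
    classOfIdeal I hI * classOfIdeal J hJ = classOfIdeal (I * J) hIJ := by
  have : fullOfIdeal I hI * fullOfIdeal J hJ = fullOfIdeal (I * J) hIJ :=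
    Subtype.ext (FractionalIdeal.coeIdeal_mul I J).symm
  exact congrArg (fun F : fullFractionalIdeals S => (F : ICM S)) this

theorem exists_classOfIdeal_eq (c : ICM S) : ∃ I hI, classOfIdeal (S := S) I hI = c := by
  induction c using Con.induction_on with
  | H c =>
  obtain ⟨F, x, hx, hux⟩ := c
  have hden := F.den_mul_self_eq_num'
  have hd := IsLocalization.map_units (FractionRing S) F.den
  have hmem : algebraMap S (FractionRing S) F.den * x ∈
      (F.num : FractionalIdeal (nonZeroDivisors S) (FractionRing S)) := by
    rw [← hden]
    exact FractionalIdeal.mul_mem_mul (FractionalIdeal.mem_spanSingleton_self _ _) hx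
  obtain ⟨r, hr, hrx⟩ := (FractionalIdeal.mem_coeIdeal _).1 hmem
  refine ⟨F.num, ⟨r, hr, ?_⟩, (Con.eq _).2 ⟨hd.unit, hden.symm⟩⟩
  exact mem_nonZeroDivisors_of_injective (IsFractionRing.injective S (FractionRing S))
    (hrx ▸ (hd.mul hux).mem_nonZeroDivisors)

end SameClass

section Approximation

variable {S : Type*} [CommRing S] {I J : Ideal S} {c q y z : S}

theorem exists_mem_mul_eq_of_span_singleton_mul_eq {a b : S}
    (h : Ideal.span {a} * I = Ideal.span {b} * J) {i : S} (hi : i ∈ I) : ∃ j ∈ J, b * j = a * i :=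
  Ideal.mem_span_singleton_mul.1 (h ▸ Ideal.mul_mem_mul (Ideal.mem_span_singleton_self a) hi)

/-- If `a I = b J`, then `y = c b⁻¹ a` and `z = c a⁻¹ b`. -/
theorem SameClass.exists_mul_eq_sq (h : SameClass I J) (hI : c ∈ I) (hJ : c ∈ J) :
    ∃ y z, y * z = c ^ 2 ∧ (∀ i ∈ I, ∃ j ∈ J, y * i = c * j) ∧ ∀ j ∈ J, ∃ i ∈ I, z * j = c * i := by
  obtain ⟨a, ha, b, hb, hab⟩ := h
  obtain ⟨y, -, hy⟩ := exists_mem_mul_eq_of_span_singleton_mul_eq hab hI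
  obtain ⟨z, -, hz⟩ := exists_mem_mul_eq_of_span_singleton_mul_eq hab.symm hJ
  refine ⟨y, z, ?_, fun i hi => ?_, fun j hj => ?_⟩
  · rw [← mul_cancel_left_mem_nonZeroDivisors (mul_mem ha hb)]
    linear_combination a * z * hy + a * c * hz
  · obtain ⟨j, hj, hij⟩ := exists_mem_mul_eq_of_span_singleton_mul_eq hab hi
    refine ⟨j, hj, ?_⟩
    rw [← mul_cancel_left_mem_nonZeroDivisors hb]
    linear_combination i * hy - c * hij
  · obtain ⟨i, hi, hij⟩ := exists_mem_mul_eq_of_span_singleton_mul_eq hab.symm hj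
    refine ⟨i, hi, ?_⟩
    rw [← mul_cancel_left_mem_nonZeroDivisors ha]
    linear_combination j * hz - c * hij

theorem sameClass_of_mul_eq (hc : c ∈ nonZeroDivisors S) (u : Sˣ) (hyz : y * z = c ^ 2 * u)
    (hy : ∀ i ∈ I, ∃ j ∈ J, y * i = c * j) (hz : ∀ j ∈ J, ∃ i ∈ I, z * j = c * i) :
    SameClass I J := by
  have hy_mem : y ∈ nonZeroDivisors S :=
    (mul_mem_nonZeroDivisors.1
      (hyz ▸ mul_mem (pow_mem hc 2) u.isUnit.mem_nonZeroDivisors)).1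
  refine ⟨y, hy_mem, c, hc, le_antisymm ?_ ?_⟩ <;>
    refine Ideal.span_singleton_mul_le_iff.2 fun x hx => Ideal.mem_span_singleton_mul.2 ?_
  · obtain ⟨j, hj, hij⟩ := hy x hx
    exact ⟨j, hj, hij.symm⟩
  · obtain ⟨i, hi, hij⟩ := hz x hx
    refine ⟨↑u⁻¹ * i, I.mul_mem_left _ hi, ?_⟩
    rw [← mul_cancel_left_mem_nonZeroDivisors (mul_mem hc u.isUnit.mem_nonZeroDivisors)]
    linear_combination c * y * i * u.mul_inv - y * hij + x * hyz

theorem exists_mem_mul_eq_of_sq_dvd_sub {a b w : S} (hI : c ∈ I) (hb : b ∈ I)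
    (h : c ^ 2 ∣ w * a - c * b) : ∃ b' ∈ I, w * a = c * b' := by
  obtain ⟨e, he⟩ := h
  exact ⟨b + c * e, add_mem hb (I.mul_mem_right _ hI), by linear_combination he⟩

theorem sameClass_of_sq_mul_dvd (hc : c ∈ nonZeroDivisors S)
    (hq : q ∈ Ideal.jacobson (⊥ : Ideal S)) (hI : c ∈ I) (hJ : c ∈ J)
    (hyz : c ^ 2 * q ∣ y * z - c ^ 2) (hy : ∀ i ∈ I, ∃ j ∈ J, c ^ 2 ∣ y * i - c * j)
    (hz : ∀ j ∈ J, ∃ i ∈ I, c ^ 2 ∣ z * j - c * i) : SameClass I J := by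
  obtain ⟨e, he⟩ := hyz
  obtain ⟨u, hu⟩ := Ideal.mem_jacobson_bot.1 hq e
  refine sameClass_of_mul_eq (y := y) (z := z) hc u ?_ (fun i hi => ?_) fun j hj => ?_
  · rw [hu]
    linear_combination he
  · obtain ⟨j, hj, hij⟩ := hy i hi
    exact exists_mem_mul_eq_of_sq_dvd_sub hJ hj hij
  · obtain ⟨i, hi, hij⟩ := hz j hj
    exact exists_mem_mul_eq_of_sq_dvd_sub hI hi hij

theorem FinitelyComplete.sameClass_iff {p : S} (h : FinitelyComplete p) {m N : ℕ}
    (hI : p ^ m ∈ I) (hJ : p ^ m ∈ J) (hN : 2 * m < N) :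
    SameClass I J ↔ ∃ y z, p ^ N ∣ y * z - p ^ (2 * m) ∧
      (∀ i ∈ I, ∃ j ∈ J, p ^ N ∣ y * i - p ^ m * j) ∧
      ∀ j ∈ J, ∃ i ∈ I, p ^ N ∣ z * j - p ^ m * i := by
  have hsq : (p ^ m) ^ 2 = p ^ (2 * m) := by rw [← pow_mul, mul_comm]
  constructor
  · intro hIJ
    obtain ⟨y, z, hyz, hy, hz⟩ := hIJ.exists_mul_eq_sq hI hJ
    refine ⟨y, z, by simp [hyz, hsq], fun i hi => ?_, fun j hj => ?_⟩
    · obtain ⟨j, hj, hij⟩ := hy i hi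
      exact ⟨j, hj, by simp [hij]⟩
    · obtain ⟨i, hi, hij⟩ := hz j hj
      exact ⟨i, hi, by simp [hij]⟩
  · rintro ⟨y, z, hyz, hy, hz⟩
    have hdvd : (p ^ m) ^ 2 ∣ p ^ N := hsq ▸ pow_dvd_pow p hN.le
    refine sameClass_of_sq_mul_dvd (q := p) (y := y) (z := z) (h.pow_mem m) h.mem_jacobson_bot hI hJ
      ?_ (fun i hi => ?_) fun j hj => ?_
    · rw [hsq, ← pow_succ]
      exact (pow_dvd_pow p hN).trans hyz
    · obtain ⟨j, hj, hij⟩ := hy i hi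
      exact ⟨j, hj, hdvd.trans hij⟩
    · obtain ⟨i, hi, hij⟩ := hz j hj
      exact ⟨i, hi, hdvd.trans hij⟩

end Approximation

section Neighbours

variable {S : Type*} [CommRing S] {p : S}

theorem exists_le_span_singleton_mul_eq {a : S} {L X : Ideal S} (h : X ≤ Ideal.span {a} * L) :
    ∃ L' ≤ L, Ideal.span {a} * L' = X := by
  refine ⟨L ⊓ Submodule.comap (LinearMap.mulLeft S a) X, inf_le_left, le_antisymm ?_ fun x hx => ?_⟩
  · exact Ideal.span_singleton_mul_le_iff.2 fun x hx => hx.2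
  · obtain ⟨l, hl, rfl⟩ := Ideal.mem_span_singleton_mul.1 (h hx)
    exact Ideal.mul_mem_mul (Ideal.mem_span_singleton_self a) ⟨hl, hx⟩

theorem le_of_span_singleton_mul_le {a : S} (ha : a ∈ nonZeroDivisors S) {I J : Ideal S}
    (h : Ideal.span {a} * I ≤ Ideal.span {a} * J) : I ≤ J := by
  intro x hx
  obtain ⟨y, hy, hxy⟩ :=
    Ideal.mem_span_singleton_mul.1 (h (Ideal.mul_mem_mul (Ideal.mem_span_singleton_self a) hx))
  rwa [← (mul_cancel_left_mem_nonZeroDivisors ha).1 hxy]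

theorem SameClass.exists_le {L J J' : Ideal S} (h : SameClass L J) (hJ : J' ≤ J)
    (hp : Ideal.span {p} * J ≤ J') :
    ∃ L' ≤ L, Ideal.span {p} * L ≤ L' ∧ SameClass L' J' := by
  obtain ⟨a, ha, b, hb, hab⟩ := h
  obtain ⟨L', hL', hL'J⟩ :=
    exists_le_span_singleton_mul_eq ((Ideal.mul_mono_right hJ).trans_eq hab.symm)
  refine ⟨L', hL', le_of_span_singleton_mul_le ha ?_, a, ha, b, hb, hL'J⟩
  rw [mul_left_comm, hab, mul_left_comm, hL'J]
  exact Ideal.mul_mono_right hp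

theorem exists_sameClass_of_neighbours {R : Set (Ideal S)} (htop : ∃ L ∈ R, SameClass L ⊤)
    (hR : ∀ L ∈ R, ∀ J ≤ L, Ideal.span {p} * L ≤ J → ∃ L' ∈ R, SameClass L' J)
    {I : Ideal S} {n : ℕ} (hI : p ^ n ∈ I) : ∃ L ∈ R, SameClass L I := by
  suffices key : ∀ t, ∃ L ∈ R, SameClass L (I ⊔ Ideal.span {p ^ t}) by
    have := key n
    rwa [sup_eq_left.2 ((Ideal.span_singleton_le_iff_mem I).2 hI)] at this
  intro t
  induction t with
  | zero => simpa using htop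
  | succ t ih =>
    obtain ⟨L, hL, hLJ⟩ := ih
    have hle : I ⊔ Ideal.span {p ^ (t + 1)} ≤ I ⊔ Ideal.span {p ^ t} :=
      sup_le_sup le_rfl (Ideal.span_singleton_le_span_singleton.2 (pow_dvd_pow p t.le_succ))
    have hmul : Ideal.span {p} * (I ⊔ Ideal.span {p ^ t}) ≤ I ⊔ Ideal.span {p ^ (t + 1)} := by
      rw [Ideal.mul_sup, Ideal.span_singleton_mul_span_singleton, ← pow_succ']
      exact sup_le_sup Ideal.mul_le_right le_rfl
    obtain ⟨L', hL'L, hpL, hL'⟩ := hLJ.exists_le hle hmul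
    obtain ⟨L'', hL''R, hL''⟩ := hR L hL L' hL'L hpL
    exact ⟨L'', hL''R, hL''.trans hL'⟩

theorem finite_ideals_mem (a : S) [Finite (S ⧸ Ideal.span {a})] :
    Finite {J : Ideal S // a ∈ J} := by
  refine Finite.of_injective
    (fun J : {J : Ideal S // a ∈ J} =>
      ((J : Ideal S).map (Ideal.Quotient.mk (Ideal.span {a})) : Set (S ⧸ Ideal.span {a})))
    fun J J' h => Subtype.ext ?_
  simpa [Ideal.comap_map_quotientMk, sup_eq_right.2 ((Ideal.span_singleton_le_iff_mem _).2 J.2),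
    sup_eq_right.2 ((Ideal.span_singleton_le_iff_mem _).2 J'.2)] using
    congrArg (Ideal.comap (Ideal.Quotient.mk (Ideal.span {a}))) (SetLike.coe_injective h)

theorem FinitelyComplete.finite_ICM (h : FinitelyComplete p) {t : ℕ}
    (ht : ∀ (I : Ideal S) (n : ℕ), p ^ n ∈ I → ∃ J, p ^ t ∈ J ∧ SameClass I J) :
    Finite (ICM S) := by
  have := h.finite_quotient_pow t
  have := finite_ideals_mem (p ^ t)
  refine Finite.of_surjective (fun J : {J : Ideal S // p ^ t ∈ J} =>
    classOfIdeal (J : Ideal S) (h.exists_mem_nonZeroDivisors J.2)) fun c => ?_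
  obtain ⟨I, hI, rfl⟩ := exists_classOfIdeal_eq c
  obtain ⟨n, hn⟩ := h.exists_pow_mem hI
  obtain ⟨J, hJ, hIJ⟩ := ht I n hn
  exact ⟨⟨J, hJ⟩, classOfIdeal_eq_iff.2 hIJ.symm⟩

end Neighbours

section Representatives

variable {S : Type*} [CommRing S] {p : S}

theorem pow_mem_mul_of_pow_mem {I J : Ideal S} {m n l : ℕ} (hI : p ^ m ∈ I) (hJ : p ^ n ∈ J)
    (hl : m + n ≤ l) : p ^ l ∈ I * J := by
  have hmul := Ideal.mul_mem_mul hI hJ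
  rw [← pow_add] at hmul
  exact Ideal.pow_mem_of_pow_mem _ hmul hl

namespace FinitelyComplete

theorem exists_representatives (h : FinitelyComplete p) {t : ℕ}
    (ht : ∀ (I : Ideal S) (n : ℕ), p ^ n ∈ I → ∃ J, p ^ t ∈ J ∧ SameClass I J) :
    ∃ (n : ℕ) (I : Fin n → Ideal S), (∀ i, p ^ t ∈ I i) ∧
      (∀ i j, SameClass (I i) (I j) → i = j) ∧
      ∀ (J : Ideal S) (m : ℕ), p ^ m ∈ J → ∃ i, SameClass (I i) J := by
  have exists_ideal : ∀ c : ICM S, ∃ (I : Ideal S) (hI : p ^ t ∈ I),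
      classOfIdeal I (h.exists_mem_nonZeroDivisors hI) = c := by
    intro c
    obtain ⟨J, hJ, rfl⟩ := exists_classOfIdeal_eq c
    obtain ⟨n, hn⟩ := h.exists_pow_mem hJ
    obtain ⟨I, hI, hJI⟩ := ht J n hn
    exact ⟨I, hI, classOfIdeal_eq_iff.2 hJI.symm⟩
  choose I hI hclass using exists_ideal
  have := h.finite_ICM ht
  obtain ⟨n, ⟨e⟩⟩ := Finite.exists_equiv_fin (ICM S)
  refine ⟨n, fun i => I (e.symm i), fun i => hI _, fun i j hij => e.symm.injective ?_,
    fun J m hm => ?_⟩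
  · rw [← hclass (e.symm i), ← hclass (e.symm j), classOfIdeal_eq_iff]
    exact hij
  · refine ⟨e (classOfIdeal J (h.exists_mem_nonZeroDivisors hm)), ?_⟩
    rw [← classOfIdeal_eq_iff (hI := h.exists_mem_nonZeroDivisors (hI _)), hclass,
      e.symm_apply_apply]

theorem bijective_classOfIdeal (h : FinitelyComplete p) {ι : Type*} {I : ι → Ideal S}
    (hI : ∀ i, ∃ x ∈ I i, x ∈ nonZeroDivisors S) (hinj : ∀ i j, SameClass (I i) (I j) → i = j)
    (hsurj : ∀ (J : Ideal S) (m : ℕ), p ^ m ∈ J → ∃ i, SameClass (I i) J) :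
    Function.Bijective fun i => classOfIdeal (I i) (hI i) := by
  refine ⟨fun i j hij => hinj i j (classOfIdeal_eq_iff.1 hij), fun c => ?_⟩
  obtain ⟨J, hJ, rfl⟩ := exists_classOfIdeal_eq c
  obtain ⟨m, hm⟩ := h.exists_pow_mem hJ
  exact (hsurj J m hm).imp fun i hi => classOfIdeal_eq_iff.2 hi

theorem sameClass_iff_quotient (h : FinitelyComplete p) {I J : Ideal S} {m N : ℕ}
    (hI : p ^ m ∈ I) (hJ : p ^ m ∈ J) (hN : 2 * m < N) :
    let π := Ideal.Quotient.mk (Ideal.span {p ^ N})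
    SameClass I J ↔ ∃ y z, y * z = π p ^ (2 * m) ∧
      (∀ s ∈ I.map π, ∃ s' ∈ J.map π, y * s = π p ^ m * s') ∧
      ∀ s' ∈ J.map π, ∃ s ∈ I.map π, z * s' = π p ^ m * s := by
  have hsurj := Ideal.Quotient.mk_surjective (I := Ideal.span {p ^ N})
  simp only [h.sameClass_iff hI hJ hN, Ideal.mem_map_iff_of_surjective _ hsurj,
    forall_exists_index, and_imp, forall_apply_eq_imp_iff₂, exists_exists_and_eq_and]
  simp only [hsurj.exists, ← map_pow, ← map_mul, Ideal.Quotient.mk_eq_mk_iff_sub_mem,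
    Ideal.mem_span_singleton]

end FinitelyComplete
end Representatives

section Completion

variable {R : Type*} [CommRing R] {J : Ideal R} {π : R}

theorem adicCompletion_pow_dvd_iff (hJ : J = Ideal.span {π}) (n : ℕ) (s : AdicCompletion J R) :
    algebraMap R (AdicCompletion J R) π ^ n ∣ s ↔ AdicCompletion.evalₐ J n s = 0 := by
  have heval : AdicCompletion.evalₐ J n s = 0 ↔ s ∈ (AdicCompletion.eval J R n).ker :=
    map_eq_zero_iff _ (Ideal.quotientEquivAlgOfEq R (by simp : J ^ n • ⊤ = J ^ n)).injective
  rw [heval, ← AdicCompletion.pow_smul_top_eq_ker_eval (hJ ▸ Submodule.fg_span_singleton π),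
    show J ^ n = Ideal.span {π ^ n} by rw [hJ, Ideal.span_singleton_pow],
    Submodule.ideal_span_singleton_smul, Submodule.mem_smul_pointwise_iff_exists]
  simp only [Submodule.mem_top, true_and, Algebra.smul_def, map_pow, dvd_def, eq_comm]

theorem adicCompletion_exists_pow_dvd_sub (hJ : J = Ideal.span {π}) (n : ℕ)
    (s : AdicCompletion J R) : ∃ r : R,
      algebraMap R (AdicCompletion J R) π ^ n ∣ s - algebraMap R (AdicCompletion J R) r := by
  obtain ⟨r, hr⟩ := Ideal.Quotient.mk_surjective (AdicCompletion.evalₐ J n s)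
  refine ⟨r, (adicCompletion_pow_dvd_iff hJ n _).2 ?_⟩
  rw [map_sub, AlgHom.commutes, ← hr, Ideal.Quotient.algebraMap_eq, sub_self]

theorem adicCompletion_pow_dvd_algebraMap_iff (hJ : J = Ideal.span {π}) (n : ℕ) (r : R) :
    algebraMap R (AdicCompletion J R) π ^ n ∣ algebraMap R (AdicCompletion J R) r ↔ π ^ n ∣ r := by
  rw [adicCompletion_pow_dvd_iff hJ, AlgHom.commutes, Ideal.Quotient.algebraMap_eq,
    Ideal.Quotient.eq_zero_iff_mem, hJ, Ideal.span_singleton_pow, Ideal.mem_span_singleton]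

theorem adicCompletion_mem_nonZeroDivisors (hJ : J = Ideal.span {π})
    (hπ : π ∈ nonZeroDivisors R) :
    algebraMap R (AdicCompletion J R) π ∈ nonZeroDivisors (AdicCompletion J R) := by
  rw [mem_nonZeroDivisors_iff_right]
  intro s hs
  refine AdicCompletion.ext_evalₐ fun n => ?_
  rw [map_zero, ← adicCompletion_pow_dvd_iff hJ]
  obtain ⟨r, c, hc⟩ := adicCompletion_exists_pow_dvd_sub hJ (n + 1) s
  have hdvd : π ^ (n + 1) ∣ π * r := by
    rw [← adicCompletion_pow_dvd_algebraMap_iff hJ, map_mul]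
    exact ⟨- algebraMap R _ π * c, by linear_combination hs - algebraMap R _ π * hc⟩
  obtain ⟨d, hd⟩ := hdvd
  have hr : r = π ^ n * d := by
    rw [← mul_cancel_left_mem_nonZeroDivisors hπ, hd]
    ring
  rw [hr, map_mul, map_pow] at hc
  exact ⟨algebraMap R _ d + algebraMap R _ π * c, by linear_combination hc⟩

theorem adicCompletion_span_algebraMap (hJ : J = Ideal.span {π}) :
    Ideal.span {algebraMap R (AdicCompletion J R) π} = J.map (algebraMap R _) := by
  conv_rhs => rw [congrArg (Ideal.map _) hJ, Ideal.map_span, Set.image_singleton]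

theorem adicCompletion_finitelyComplete [Finite (R ⧸ J)] (hJ : J = Ideal.span {π})
    (hπ : π ∈ nonZeroDivisors R) :
    FinitelyComplete (algebraMap R (AdicCompletion J R) π) := by
  have hfg : J.FG := hJ ▸ Submodule.fg_span_singleton π
  have hspan := adicCompletion_span_algebraMap hJ
  refine ⟨adicCompletion_mem_nonZeroDivisors hJ hπ, ?_, ?_⟩
  · rw [hspan, ← AdicCompletion.ker_evalOneₐ_eq_map J hfg]
    exact Finite.of_injective _
      (RingHom.kerLift_injective (AdicCompletion.evalOneₐ J : AdicCompletion J R →+* R ⧸ J))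
  · rw [hspan]
    exact (IsAdicComplete.map_algebraMap_iff _ _).2 (AdicCompletion.isAdicComplete hfg)

theorem adicCompletion_exists_map_eq (hJ : J = Ideal.span {π}) {I : Ideal (AdicCompletion J R)}
    {n : ℕ} (hI : algebraMap R (AdicCompletion J R) π ^ n ∈ I) :
    ∃ I₀ : Ideal R, I₀.map (algebraMap R (AdicCompletion J R)) = I ∧ π ^ n ∈ I₀ := by
  set φ := algebraMap R (AdicCompletion J R)
  have hmem : π ^ n ∈ I.comap φ := by rwa [Ideal.mem_comap, map_pow]
  refine ⟨I.comap φ, le_antisymm Ideal.map_comap_le fun s hs => ?_, hmem⟩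
  obtain ⟨r, c, hc⟩ := adicCompletion_exists_pow_dvd_sub hJ n s
  have hr : φ r ∈ I := by
    rw [show φ r = s - φ π ^ n * c by linear_combination -hc]
    exact sub_mem hs (I.mul_mem_right _ hI)
  rw [show s = φ r + φ (π ^ n) * c by rw [map_pow]; linear_combination hc]
  exact add_mem (Ideal.mem_map_of_mem _ hr) (Ideal.mul_mem_right _ _ (Ideal.mem_map_of_mem _ hmem))

end Completion

section Conductor

variable {R O : Type*} [CommRing R] [CommRing O] [Algebra R O] {D : R}

/-- The ideal of the elements of `R` that are divisible by `D` in the extension `O` of `R`. It is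
used for `D` with `D O ⊆ R`, when it is the ideal `D O` of both rings, as the conductor is. -/
def multiplesIdeal (O : Type*) [CommRing O] [Algebra R O] (D : R) : Ideal R :=
  (Ideal.span {algebraMap R O D}).comap (algebraMap R O)

theorem self_mem_multiplesIdeal : D ∈ multiplesIdeal O D :=
  Ideal.mem_comap.2 (Ideal.mem_span_singleton_self _)

theorem exists_mem_mul_multiplesIdeal
    (hD : ∀ o : O, ∃ r, algebraMap R O r = algebraMap R O D * o) {X : Ideal R} {w : O}
    (hw : w ∈ X.map (algebraMap R O)) :
    ∃ r ∈ X * multiplesIdeal O D, algebraMap R O r = algebraMap R O D * w := by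
  suffices ∀ q : O, ∃ r ∈ X * multiplesIdeal O D,
      algebraMap R O r = algebraMap R O D * (q * w) by simpa using this 1
  refine Submodule.span_induction (p := fun w _ => ∀ q : O, ∃ r ∈ X * multiplesIdeal O D,
    algebraMap R O r = algebraMap R O D * (q * w)) ?_ ?_ ?_ ?_ hw
  · rintro _ ⟨x, hx, rfl⟩ q
    obtain ⟨r, hr⟩ := hD q
    refine ⟨x * r, Ideal.mul_mem_mul hx ?_, ?_⟩
    · exact Ideal.mem_comap.2 (Ideal.mem_span_singleton.2 ⟨q, hr⟩)
    · rw [map_mul, hr]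
      ring
  · exact fun q => ⟨0, zero_mem _, by simp⟩
  · intro u v _ _ hu hv q
    obtain ⟨r, hr, hru⟩ := hu q
    obtain ⟨s, hs, hsv⟩ := hv q
    exact ⟨r + s, add_mem hr hs, by rw [map_add, hru, hsv]; ring⟩
  · intro a u _ hu q
    obtain ⟨r, hr, hru⟩ := hu (q * a)
    exact ⟨r, hr, by rw [hru, smul_eq_mul, mul_assoc]⟩

theorem mul_multiplesIdeal [FaithfulSMul R O]
    (hD : ∀ o : O, ∃ r, algebraMap R O r = algebraMap R O D * o) (X : Ideal R) :
    X * multiplesIdeal O D =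
      (Ideal.span {algebraMap R O D} * X.map (algebraMap R O)).comap (algebraMap R O) := by
  refine le_antisymm (Ideal.mul_le.2 fun x hx r hr => ?_) fun r hr => ?_
  · obtain ⟨q, hq⟩ := Ideal.mem_span_singleton.1 (Ideal.mem_comap.1 hr)
    rw [Ideal.mem_comap, map_mul, hq, mul_left_comm, mul_comm _ q]
    exact Ideal.mul_mem_mul (Ideal.mem_span_singleton_self _)
      (Ideal.mul_mem_left _ _ (Ideal.mem_map_of_mem _ hx))
  · obtain ⟨w, hw, hwr⟩ := Ideal.mem_span_singleton_mul.1 (Ideal.mem_comap.1 hr)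
    obtain ⟨r', hr', hrw⟩ := exists_mem_mul_multiplesIdeal hD hw
    rwa [← FaithfulSMul.algebraMap_injective R O (hrw.trans hwr)]

/-- Every ideal of a Dedekind domain is generated by any one of its nonzero elements and one more
element. Multiplication by `D` brings that second generator of `I O` back to `R`. -/
theorem exists_mul_multiplesIdeal_eq [IsDedekindDomain O] [FaithfulSMul R O]
    (hD : ∀ o : O, ∃ r, algebraMap R O r = algebraMap R O D * o) (I : Ideal R) {t : R}
    (ht : t ∈ I) (ht0 : t ≠ 0) :
    ∃ a, Ideal.span {D} * I * multiplesIdeal O D =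
      (Ideal.span {a} ⊔ Ideal.span {D * t}) * multiplesIdeal O D := by
  have hle : Ideal.span {algebraMap R O t} ≤ I.map (algebraMap R O) :=
    (Ideal.span_singleton_le_iff_mem _).2 (Ideal.mem_map_of_mem _ ht)
  have hne : Ideal.span {algebraMap R O t} ≠ 0 := by
    rwa [Ne, Ideal.zero_eq_bot, Ideal.span_singleton_eq_bot,
      map_eq_zero_iff _ (FaithfulSMul.algebraMap_injective R O)]
  obtain ⟨o, ho⟩ := IsDedekindDomain.exists_sup_span_eq hle hne
  obtain ⟨a, ha⟩ := hD o
  refine ⟨a, ?_⟩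
  rw [mul_multiplesIdeal hD, mul_multiplesIdeal hD, Ideal.map_mul, Ideal.map_sup, ← ho]
  simp only [Ideal.map_span, Set.image_singleton, map_mul, ha]
  simp only [← Ideal.span_singleton_mul_span_singleton, ← Ideal.mul_sup]
  rw [sup_comm]

end Conductor

section Bound

theorem exists_sameClass_of_span_mul_mul_eq {S : Type*} [CommRing S] {I C : Ideal S} {d a : S}
    (hd : d ∈ nonZeroDivisors S) (ha : a ∈ nonZeroDivisors S) (hdC : d ∈ C)
    (h : Ideal.span {d} * I * C = Ideal.span {a} * C) : ∃ L, d * d ∈ L ∧ SameClass I L := by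
  have hle : Ideal.span {d * d} * I ≤ Ideal.span {a} * C := by
    rw [← Ideal.span_singleton_mul_span_singleton, mul_assoc, mul_comm, ← h]
    exact Ideal.mul_mono_right ((Ideal.span_singleton_le_iff_mem C).2 hdC)
  obtain ⟨L, -, hL⟩ := exists_le_span_singleton_mul_eq hle
  refine ⟨L, ?_, d * d, mul_mem hd hd, a, ha, hL.symm⟩
  have hdC_le : Ideal.span {d} * C ≤ L * C := by
    refine le_of_span_singleton_mul_le ha (le_of_eq ?_)
    rw [← mul_assoc _ L, hL, mul_left_comm, ← h, ← Ideal.span_singleton_mul_span_singleton]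
    simp only [mul_assoc]
  exact Ideal.mul_le_left (hdC_le (Ideal.mul_mem_mul (Ideal.mem_span_singleton_self d) hdC))

namespace FinitelyComplete

variable {S : Type*} [CommRing S] {p : S}

theorem span_mul_mul_eq (h : FinitelyComplete p) {I C : Ideal S} {d a : S} {n : ℕ}
    (hn : p ^ n ∈ I)
    (ha : Ideal.span {d} * I * C = (Ideal.span {a} ⊔ Ideal.span {d * p ^ (n + 1)}) * C) :
    Ideal.span {d} * I * C = Ideal.span {a} * C := by
  have := h.isNoetherianRing
  rw [Ideal.sup_mul] at ha
  have hle : Ideal.span {d * p ^ (n + 1)} * C ≤ Ideal.span {p} * (Ideal.span {d} * I * C) := by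
    rw [pow_succ', mul_left_comm, ← Ideal.span_singleton_mul_span_singleton, mul_assoc,
      ← Ideal.span_singleton_mul_span_singleton]
    exact Ideal.mul_mono_right (Ideal.mul_mono_left
      (Ideal.mul_mono_right ((Ideal.span_singleton_le_iff_mem I).2 hn)))
  refine le_antisymm ?_ (ha ▸ le_sup_left)
  refine Submodule.le_of_le_smul_of_le_jacobson_bot (I := Ideal.span {p})
    (IsNoetherian.noetherian _) ((Ideal.span_singleton_le_iff_mem _).2 h.mem_jacobson_bot) ?_
  exact ha.le.trans (sup_le_sup le_rfl hle)

theorem exists_sameClass_of_mul_eq (h : FinitelyComplete p) {I C : Ideal S} {d a : S} {m n : ℕ}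
    (hd : d ∣ p ^ m) (hdC : d ∈ C) (hn : p ^ n ∈ I)
    (ha : Ideal.span {d} * I * C = (Ideal.span {a} ⊔ Ideal.span {d * p ^ (n + 1)}) * C) :
    ∃ L, p ^ (2 * m) ∈ L ∧ SameClass I L := by
  have hd_mem : d ∈ nonZeroDivisors S := by
    obtain ⟨c, hc⟩ := hd
    exact (mul_mem_nonZeroDivisors.1 (hc ▸ h.pow_mem m)).1
  have hIC := h.span_mul_mul_eq hn ha
  have ha_mem : a ∈ nonZeroDivisors S := by
    obtain ⟨c, -, hc⟩ := Ideal.mem_span_singleton_mul.1 (hIC ▸ Ideal.mul_mem_mul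
      (Ideal.mul_mem_mul (Ideal.mem_span_singleton_self d) hn) hdC)
    exact (mul_mem_nonZeroDivisors.1
      (hc ▸ mul_mem (mul_mem hd_mem (h.pow_mem n)) hd_mem)).1
  obtain ⟨L, hL, hIL⟩ := exists_sameClass_of_span_mul_mul_eq hd_mem ha_mem hdC hIC
  refine ⟨L, L.mem_of_dvd ?_ hL, hIL⟩
  rw [two_mul, pow_add]
  exact mul_dvd_mul hd hd

end FinitelyComplete

theorem exists_pow_mem_sameClass_of_isDedekindDomain {R : Type*} [CommRing R]
    (O : Type*) [CommRing O] [IsDedekindDomain O] [Algebra R O] [FaithfulSMul R O] {J : Ideal R}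
    {π D : R} (hJ : J = Ideal.span {π}) (hπ : π ≠ 0)
    (hS : FinitelyComplete (algebraMap R (AdicCompletion J R) π))
    (hD : ∀ o : O, ∃ r, algebraMap R O r = algebraMap R O D * o) {m : ℕ}
    (hDm : algebraMap R (AdicCompletion J R) D ∣ algebraMap R (AdicCompletion J R) π ^ m)
    {I : Ideal (AdicCompletion J R)} {n : ℕ}
    (hI : algebraMap R (AdicCompletion J R) π ^ n ∈ I) :
    ∃ L, algebraMap R (AdicCompletion J R) π ^ (2 * m) ∈ L ∧ SameClass I L := by
  have := (FaithfulSMul.algebraMap_injective R O).isDomain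
  obtain ⟨I₀, rfl, hI₀⟩ := adicCompletion_exists_map_eq hJ hI
  obtain ⟨a, ha⟩ := exists_mul_multiplesIdeal_eq hD I₀
    (t := π ^ (n + 1)) (I₀.mem_of_dvd (pow_dvd_pow π n.le_succ) hI₀) (pow_ne_zero _ hπ)
  have ha' := congrArg (Ideal.map (algebraMap R (AdicCompletion J R))) ha
  simp only [Ideal.map_mul, Ideal.map_sup, Ideal.map_span, Set.image_singleton, map_mul,
    map_pow] at ha'
  exact hS.exists_sameClass_of_mul_eq hDm (Ideal.mem_map_of_mem _ self_mem_multiplesIdeal) hI ha'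

end Bound

theorem isSeparable_of_aeval_derivative_ne_zero {F K : Type*} [Field F] [Field K] [Algebra F K]
    {x : K} {g : F[X]} (hg : aeval x g = 0)
    (hg' : aeval x (derivative g) ≠ 0) : IsSeparable F x := by
  have hx : IsIntegral F x := IsAlgebraic.isIntegral ⟨g, fun h => by simp [h] at hg', hg⟩
  obtain ⟨h, rfl⟩ := minpoly.dvd F x hg
  rw [derivative_mul, map_add, map_mul, map_mul, minpoly.aeval, zero_mul,
    add_zero] at hg'
  refine (separable_iff_derivative_ne_zero (minpoly.irreducible hx)).2 fun h0 => ?_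
  simp [h0] at hg'

section FiniteExtension

variable {B R : Type*} [CommRing B] [CommRing R] [Algebra B R]
  (K L : Type*) [Field K] [Field L] [Algebra B K] [Algebra R L]
  [IsFractionRing R L] [Algebra K L] [Algebra B L] [IsScalarTower B K L] [IsScalarTower B R L]

theorem isSeparable_of_adjoin_singleton_eq_top {θ : R} (hθ : Algebra.adjoin B {θ} = ⊤) {F : B[X]}
    (hF : aeval θ F = 0)
    (hF' : aeval θ (derivative F) ≠ 0) : Algebra.IsSeparable K L := by
  have aeval_map (g : B[X]) : aeval (algebraMap R L θ) (g.map (algebraMap B K)) =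
      algebraMap R L (aeval θ g) := by
    rw [aeval_map_algebraMap, aeval_algebraMap_apply]
  have hsep : IsSeparable K (algebraMap R L θ) := by
    refine isSeparable_of_aeval_derivative_ne_zero (g := F.map (algebraMap B K)) ?_ ?_
    · rw [aeval_map, hF, map_zero]
    · rwa [derivative_map, aeval_map, Ne,
        map_eq_zero_iff _ (IsFractionRing.injective R L)]
  have htop : IntermediateField.adjoin K {algebraMap R L θ} = ⊤ := by
    refine eq_top_iff.2 fun y _ => ?_
    have hR (r : R) : algebraMap R L r ∈ IntermediateField.adjoin K {algebraMap R L θ} := by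
      have hr : r ∈ Algebra.adjoin B {θ} := hθ ▸ Algebra.mem_top
      obtain ⟨g, rfl⟩ := Algebra.adjoin_singleton_eq_range_aeval B θ ▸ hr
      change algebraMap R L (aeval θ g) ∈ _
      rw [← aeval_map]
      exact IntermediateField.algebra_adjoin_le_adjoin _ _
        (aeval_mem_adjoin_singleton K _)
    obtain ⟨a, b, -, rfl⟩ := IsFractionRing.div_surjective (A := R) y
    exact div_mem (hR a) (hR b)
  have := (IntermediateField.isSeparable_adjoin_simple_iff_isSeparable K L).2 hsep
  rw [htop] at this
  exact AlgEquiv.Algebra.isSeparable (IntermediateField.topEquiv (F := K) (E := L))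

theorem integralClosure_isDedekindDomain_and_finite [IsDedekindDomain B] [IsDomain R]
    [FaithfulSMul B R] [Module.Finite B R] [IsFractionRing B K] [Algebra.IsSeparable K L] :
    IsDedekindDomain (integralClosure R L) ∧ Module.Finite R (integralClosure R L) := by
  have : FiniteDimensional K L := .of_isLocalization B R (nonZeroDivisors B)
  have : IsIntegralClosure (integralClosure R L) B L := by
    refine ⟨Subtype.val_injective, fun {y} => ⟨fun hy => ⟨⟨y, hy.tower_top⟩, rfl⟩, ?_⟩⟩
    rintro ⟨z, rfl⟩
    exact isIntegral_trans (R := B) (A := R) _ z.2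
  have := IsIntegralClosure.finite B K L (integralClosure R L)
  exact ⟨IsIntegralClosure.isDedekindDomain B K L _, .of_restrictScalars_finite B R _⟩

end FiniteExtension

theorem normalization_of_simple_root {B R : Type*} [CommRing B] [IsDedekindDomain B] [CommRing R]
    [IsDomain R] [Algebra B R] [FaithfulSMul B R] {θ : R} (hθ : Algebra.adjoin B {θ} = ⊤)
    {F : B[X]} (hF : F.Monic) (h0 : aeval θ F = 0)
    (h1 : aeval θ (derivative F) ≠ 0) :
    IsDedekindDomain (integralClosure R (FractionRing R)) ∧
      Module.Finite R (integralClosure R (FractionRing R)) := by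
  have : Module.Finite B R := by
    have hθint : IsIntegral B θ := ⟨F, hF, h0⟩
    have := hθint.fg_adjoin_singleton
    rw [hθ] at this
    exact ⟨this⟩
  let := FractionRing.liftAlgebra B (FractionRing R)
  have := FractionRing.isScalarTower_liftAlgebra B (FractionRing R)
  have := isSeparable_of_adjoin_singleton_eq_top (FractionRing B) (FractionRing R) hθ h0 h1
  exact integralClosure_isDedekindDomain_and_finite (B := B) (FractionRing B) (FractionRing R)

section InnerDerivative

variable {A : Type*} [CommRing A]

/-- The derivative of a bivariate polynomial with respect to the variable of its coefficients. -/
noncomputable def innerDerivative (f : A[X][X]) : A[X][X] :=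
  ∑ i ∈ Finset.range (f.natDegree + 1), monomial i (derivative (f.coeff i))

theorem coeff_innerDerivative (f : A[X][X]) (i : ℕ) :
    (innerDerivative f).coeff i = derivative (f.coeff i) := by
  simp only [innerDerivative, finsetSum_coeff, coeff_monomial, Finset.sum_ite_eq',
    Finset.mem_range, Order.lt_add_one_iff, ite_eq_left_iff, not_le]
  intro h
  rw [coeff_eq_zero_of_natDegree_lt h, derivative_zero]

theorem innerDerivative_add (f g : A[X][X]) :
    innerDerivative (f + g) = innerDerivative f + innerDerivative g := by
  ext1 i
  simp [coeff_innerDerivative]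

theorem innerDerivative_monomial (n : ℕ) (a : A[X]) :
    innerDerivative (monomial n a) = monomial n (derivative a) := by
  ext1 i
  rw [coeff_innerDerivative, coeff_monomial, coeff_monomial]
  split_ifs <;> simp

theorem exists_pow_eq_of_derivative_eq_zero [IsDomain A] (p : ℕ) [Fact p.Prime] [CharP A p]
    [PerfectRing A p] {f : A[X][X]} (h : derivative f = 0) (hi : innerDerivative f = 0) :
    ∃ g, g ^ p = f := by
  have hp : p ≠ 0 := NeZero.ne p
  have hcoeff (i : ℕ) : ∃ d : A[X], d ^ p = (contract p f).coeff i := by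
    have : derivative ((contract p f).coeff i) = 0 := by
      rw [coeff_contract hp, ← coeff_innerDerivative, hi, coeff_zero]
    rw [← expand_contract p this hp, polynomial_expand_eq]
    exact ⟨_, rfl⟩
  choose d hd using hcoeff
  refine ⟨∑ i ∈ Finset.range ((contract p f).natDegree + 1), monomial i (d i), ?_⟩
  conv_rhs => rw [← expand_contract p h hp, (contract p f).as_sum_range]
  rw [← map_frobenius_expand, map_expand, Polynomial.map_sum]
  simp only [map_monomial, frobenius_def, hd]

theorem innerDerivative_ne_zero {k : Type*} [Field k] [PerfectField k] {f : k[X][X]}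
    (hf : Irreducible f) (h : derivative f = 0) : innerDerivative f ≠ 0 := by
  intro hi
  obtain ⟨p, hp⟩ := CharP.exists k
  rcases CharP.char_is_prime_or_zero k p with hprime | rfl
  · have := Fact.mk hprime
    have : PerfectRing k p := PerfectField.toPerfectRing p
    obtain ⟨g, rfl⟩ := exists_pow_eq_of_derivative_eq_zero p h hi
    exact not_irreducible_pow hprime.ne_one hf
  · have := CharP.charP_to_charZero k
    obtain ⟨a, rfl⟩ := natDegree_eq_zero.1 (derivative_eq_zero.1 h)
    have ha : derivative a = 0 := by simpa [coeff_innerDerivative] using congrArg (coeff · 0) hi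
    obtain ⟨c, rfl⟩ := natDegree_eq_zero.1 (derivative_eq_zero.1 ha)
    exact hf.not_isUnit (((isUnit_iff_ne_zero.2 (by rintro rfl; simp at hf)).map C).map C)

end InnerDerivative

section Shear

/-- The automorphism `T ↦ x`, `x ↦ T + x ^ N` of `A[T][x]`. For `N` large it preserves a given monic
polynomial's being monic, as in Noether normalization, while it turns the `T`-derivative into the
`x`-derivative: this replaces an inseparable projection of a plane curve by a separable one. -/
noncomputable def shear (A : Type*) [CommRing A] (N : ℕ) : A[X][X] ≃+* A[X][X] :=
  .ofRingHom (eval₂RingHom (eval₂RingHom (C.comp C) X) (C X + X ^ N))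
    (eval₂RingHom (eval₂RingHom (C.comp C) (X - C X ^ N)) (C X))
    (by ext : 3 <;> simp [eval₂_pow]) (by ext : 3 <;> simp [eval₂_pow])

variable {A : Type*} [CommRing A]

theorem shear_apply (N : ℕ) (f : A[X][X]) :
    shear A N f = eval₂ (eval₂RingHom (C.comp C) X) (C X + X ^ N) f :=
  rfl

theorem derivative_shear (N : ℕ) (f : A[X][X]) :
    derivative (shear A N f) = shear A N (innerDerivative f) +
      shear A N (derivative f) * derivative (C X + X ^ N) := by
  have derivative_eval₂ (a : A[X]) : derivative (eval₂ (C.comp C : A →+* A[X][X]) X a) =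
      eval₂ (C.comp C) X (derivative a) := by
    change derivative (a.map C) = (derivative a).map C
    exact derivative_map a C
  induction f using Polynomial.induction_on' with
  | add f g hf hg =>
    generalize derivative (C X + X ^ N : A[X][X]) = c at hf hg ⊢
    simp only [map_add, hf, hg, innerDerivative_add]
    ring
  | monomial n a =>
    rw [innerDerivative_monomial, derivative_monomial]
    simp only [shear_apply, coe_eval₂RingHom, eval₂_monomial, derivative_mul, derivative_eval₂,
      derivative_pow, map_mul, map_natCast]
    ring

theorem natDegree_shear_term_lt [Nontrivial A] {a : A[X]} {N i d : ℕ} (ha : a.natDegree < N)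
    (hi : i < d) :
    (a.map C * (C X + X ^ N : A[X][X]) ^ i).natDegree < d * N := by
  have hdeg : (C X + X ^ N : A[X][X]).natDegree = N := by
    rw [add_comm, natDegree_X_pow_add_C]
  calc (a.map C * (C X + X ^ N : A[X][X]) ^ i).natDegree
      ≤ a.natDegree + i * N := by
        refine natDegree_mul_le.trans (add_le_add natDegree_map_le ?_)
        exact natDegree_pow_le.trans_eq (by rw [hdeg])
    _ < N + i * N := by gcongr
    _ = (i + 1) * N := by ring
    _ ≤ d * N := Nat.mul_le_mul_right N hi

theorem monic_shear {f : A[X][X]} (hf : f.Monic) {N : ℕ}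
    (hN : ∀ i, (f.coeff i).natDegree < N) : (shear A N f).Monic := by
  nontriviality A
  have hmonic : (C X + X ^ N : A[X][X]).Monic := by
    rw [add_comm]
    exact monic_X_pow_add_C _ (hN 0).ne_bot
  have hdeg : ((C X + X ^ N : A[X][X]) ^ f.natDegree).natDegree = f.natDegree * N := by
    rw [hmonic.natDegree_pow, add_comm, natDegree_X_pow_add_C]
  have hsum : shear A N f = (C X + X ^ N) ^ f.natDegree + ∑ i ∈ Finset.range f.natDegree,
      (f.coeff i).map C * (C X + X ^ N : A[X][X]) ^ i := by
    rw [shear_apply, eval₂_eq_sum_range, Finset.sum_range_succ, add_comm,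
      hf.coeff_natDegree, map_one, one_mul]
    rfl
  rw [hsum]
  refine Monic.add_of_left (hmonic.pow _) ?_
  rw [degree_eq_natDegree (hmonic.pow _).ne_zero, hdeg]
  refine (degree_sum_le _ _).trans_lt ((Finset.sup_lt_iff (WithBot.bot_lt_coe _)).2 fun i hi => ?_)
  exact degree_le_natDegree.trans_lt
    (Nat.cast_lt.2 (natDegree_shear_term_lt (hN i) (Finset.mem_range.1 hi)))

end Shear

section Normalization

theorem exists_natDegree_coeff_lt {A : Type*} [Semiring A] (f : A[X][X]) :
    ∃ N, ∀ i, (f.coeff i).natDegree < N := by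
  refine ⟨f.support.sup (fun i => (f.coeff i).natDegree) + 1, fun i => Nat.lt_succ_of_le ?_⟩
  by_cases hi : i ∈ f.support
  · exact Finset.le_sup (f := fun i => (f.coeff i).natDegree) hi
  · simp [notMem_support_iff.1 hi]

variable {B R : Type*} [CommRing B] [CommRing R] {f : B[X]} {q : B[X] →+* R}

theorem map_ne_zero_of_natDegree_lt [IsDomain B] (hker : RingHom.ker q = Ideal.span {f}) {g : B[X]}
    (hg : g ≠ 0) (hgf : g.natDegree < f.natDegree) : q g ≠ 0 := by
  intro h
  rw [← RingHom.mem_ker, hker, Ideal.mem_span_singleton] at h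
  exact hgf.not_ge (natDegree_le_of_dvd h hg)

theorem natDegree_pos_of_ker_eq_span [Nontrivial R] (hf : f.Monic)
    (hker : RingHom.ker q = Ideal.span {f}) : 0 < f.natDegree := by
  refine Nat.pos_of_ne_zero fun h => RingHom.ker_ne_top q ?_
  rw [hker, eq_one_of_monic_natDegree_zero hf h, Ideal.span_singleton_one]

theorem normalization_of_derivative_ne_zero [IsDedekindDomain B] [IsDomain R] (hf : f.Monic)
    (hf' : derivative f ≠ 0) (hq : Function.Surjective q) (hker : RingHom.ker q = Ideal.span {f}) :
    IsDedekindDomain (integralClosure R (FractionRing R)) ∧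
      Module.Finite R (integralClosure R (FractionRing R)) := by
  have hd := natDegree_pos_of_ker_eq_span hf hker
  let : Algebra B R := (q.comp C).toAlgebra
  have aeval_eq (g : B[X]) : aeval (q X) g = q g := by
    change eval₂ (q.comp C) (q X) g = q g
    rw [← hom_eval₂, eval₂_C_X]
  have : FaithfulSMul B R := by
    refine (faithfulSMul_iff_algebraMap_injective B R).2 ((injective_iff_map_eq_zero _).2 ?_)
    intro b hb
    by_contra hb0
    exact map_ne_zero_of_natDegree_lt hker (C_ne_zero.2 hb0) (by rwa [natDegree_C]) hb
  have hgen : Algebra.adjoin B {q X} = ⊤ := by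
    refine eq_top_iff.2 fun r _ => ?_
    obtain ⟨g, rfl⟩ := hq r
    exact aeval_eq g ▸ aeval_mem_adjoin_singleton B _
  refine normalization_of_simple_root hgen hf ?_ ?_
  · rw [aeval_eq, ← RingHom.mem_ker, hker]
    exact Ideal.mem_span_singleton_self f
  · rw [aeval_eq]
    exact map_ne_zero_of_natDegree_lt hker hf' (natDegree_derivative_lt hd.ne')

theorem normalization_of_ker_eq_span_irreducible {k : Type*} [Field k] [PerfectField k]
    [IsDomain R] {f : k[X][X]} (hf : f.Monic) (hirr : Irreducible f) {q : k[X][X] →+* R}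
    (hq : Function.Surjective q) (hker : RingHom.ker q = Ideal.span {f}) :
    IsDedekindDomain (integralClosure R (FractionRing R)) ∧
      Module.Finite R (integralClosure R (FractionRing R)) := by
  by_cases h : derivative f = 0
  · obtain ⟨N, hN⟩ := exists_natDegree_coeff_lt f
    refine normalization_of_derivative_ne_zero (f := shear k N f)
      (q := q.comp (shear k N).symm.toRingHom) (monic_shear hf hN) ?_
      (hq.comp (shear k N).symm.surjective) ?_
    · rw [derivative_shear, h, map_zero, zero_mul, add_zero]
      exact (map_ne_zero_iff _ (shear k N).injective).2 (innerDerivative_ne_zero hirr h)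
    · rw [← RingHom.comap_ker, hker]
      exact (Ideal.comap_symm (shear k N)).trans (by rw [Ideal.map_span, Set.image_singleton])
  · exact normalization_of_derivative_ne_zero hf h hq hker

end Normalization

section Lists

variable {S : Type*} [Semiring S]

theorem coeff_ofCoeffs (l : List S) (i : ℕ) : (ofCoeffs l).coeff i = l.getD i 0 := by
  induction l generalizing i with
  | nil => simp [ofCoeffs]
  | cons a l ih =>
    cases i with
    | zero => simp [ofCoeffs]
    | succ i => simp [ofCoeffs, ih]

theorem ofCoeffs_eq_zero_iff {l : List S} : ofCoeffs l = 0 ↔ ∀ a ∈ l, a = 0 := by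
  simp only [Polynomial.ext_iff, coeff_ofCoeffs, coeff_zero]
  refine ⟨fun h a ha => ?_, fun h i => ?_⟩
  · obtain ⟨i, hi, rfl⟩ := List.getElem_of_mem ha
    rw [← List.getD_eq_getElem l 0 hi, h i]
  · by_cases hi : i < l.length
    · rw [List.getD_eq_getElem l 0 hi]
      exact h _ (List.getElem_mem hi)
    · exact List.getD_eq_default l 0 (not_lt.1 hi)

theorem degree_ofCoeffs_lt {l : List S} {n : ℕ} (h : l.length ≤ n) : (ofCoeffs l).degree < n := by
  rw [degree_lt_iff_coeff_zero]
  intro i hi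
  rw [coeff_ofCoeffs, List.getD_eq_default _ _ (h.trans hi)]

theorem ofCoeffs_map_range {a : S[X]} {n : ℕ} (h : a.degree < n) :
    ofCoeffs ((List.range n).map a.coeff) = a := by
  ext i
  rw [coeff_ofCoeffs]
  by_cases hi : i < n
  · simp [List.getD_eq_getElem?_getD, hi]
  · rw [List.getD_eq_default _ _ (by simpa using hi)]
    exact ((degree_lt_iff_coeff_zero a n).1 h i (not_lt.1 hi)).symm

theorem coeff_ofCoeffs₂ {k : Type*} [Field k] (l : List (List k)) (i : ℕ) :
    (ofCoeffs₂ l).coeff i = ofCoeffs (l.getD i []) := by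
  rw [ofCoeffs₂, coeff_ofCoeffs]
  exact List.getD_map l [] ofCoeffs

end Lists

section Reduced

/-- The lists of at most `n` lists of length at most `M`: through `ofCoeffs₂` these are the
bivariate polynomials of degree `< n` with coefficients of degree `< M`. -/
def IsReduced {κ : Type*} (n M : ℕ) (l : List (List κ)) : Prop :=
  l.length ≤ n ∧ ∀ c ∈ l, c.length ≤ M

theorem finite_isReduced {κ : Type*} [Finite κ] (n M : ℕ) :
    {l : List (List κ) | IsReduced n M l}.Finite := by
  have := (List.finite_length_le κ M).to_subtype
  refine ((List.finite_length_le {c : List κ | c.length ≤ M} n).image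
    (List.map Subtype.val)).subset fun l hl => ?_
  refine ⟨l.attach.map fun c => ⟨c.1, hl.2 c.1 c.2⟩, ?_, by simp⟩
  exact ((List.length_map _).trans l.length_attach).trans_le hl.1

variable {k : Type*} [Field k] {n M : ℕ} {l l' : List (List k)}

theorem IsReduced.degree_lt (hl : IsReduced n M l) : (ofCoeffs₂ l).degree < n :=
  degree_ofCoeffs_lt (by simpa using hl.1)

theorem IsReduced.degree_coeff_lt (hl : IsReduced n M l) (i : ℕ) :
    ((ofCoeffs₂ l).coeff i).degree < M := by
  rw [coeff_ofCoeffs₂]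
  refine degree_ofCoeffs_lt ?_
  rw [List.getD_eq_getElem?_getD]
  rcases h : l[i]? with _ | c
  · simp
  · exact hl.2 c (List.mem_of_getElem? h)

theorem exists_isReduced_of_degree_lt {r : k[X][X]} {n : ℕ} (hr : r.degree < n) {Q : k[X]}
    (hQ : Q ≠ 0) :
    ∃ l, IsReduced n Q.natDegree l ∧ ∃ v, r = ofCoeffs₂ l + v * C Q := by
  have coeff_sum (c : ℕ → k[X]) (i : ℕ) :
      (∑ j ∈ Finset.range n, monomial j (c j)).coeff i = if i < n then c i else 0 := by
    simp [finsetSum_coeff, coeff_monomial]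
  refine ⟨(List.range n).map fun i => (List.range Q.natDegree).map (r.coeff i % Q).coeff,
    ⟨by simp, by simp⟩, ∑ j ∈ Finset.range n, monomial j (r.coeff j / Q), ?_⟩
  ext1 i
  rw [coeff_add, coeff_mul_C, coeff_sum, coeff_ofCoeffs₂]
  split_ifs with hi
  · have hmod : (r.coeff i % Q).degree < Q.natDegree := by
      rw [← degree_eq_natDegree hQ]
      exact EuclideanDomain.mod_lt _ hQ
    rw [List.getD_eq_getElem _ _ (by simpa using hi)]
    simp only [List.getElem_map, List.getElem_range]
    rw [ofCoeffs_map_range hmod, mul_comm, EuclideanDomain.mod_add_div]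
  · rw [List.getD_eq_default _ _ (by simpa using hi), (degree_lt_iff_coeff_zero r n).1 hr i
      (not_lt.1 hi)]
    simp [ofCoeffs]

theorem IsReduced.eq_of_C_dvd_sub {Q : k[X]} (hM : M ≤ Q.natDegree) (hl : IsReduced n M l)
    (hl' : IsReduced n M l') (h : C Q ∣ ofCoeffs₂ l - ofCoeffs₂ l') :
    ofCoeffs₂ l = ofCoeffs₂ l' := by
  ext1 i
  have hdvd : Q ∣ (ofCoeffs₂ l).coeff i - (ofCoeffs₂ l').coeff i := by
    rw [← coeff_sub]
    exact (C_dvd_iff_dvd_coeff _ _).1 h i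
  rcases eq_or_ne Q 0 with rfl | hQ
  · exact sub_eq_zero.1 (zero_dvd_iff.1 hdvd)
  refine sub_eq_zero.1 (eq_zero_of_dvd_of_degree_lt hdvd ((degree_sub_le _ _).trans_lt ?_))
  rw [degree_eq_natDegree hQ]
  exact max_lt ((hl.degree_coeff_lt i).trans_le (Nat.cast_le.2 hM))
    ((hl'.degree_coeff_lt i).trans_le (Nat.cast_le.2 hM))

theorem C_dvd_of_dvd_mk {A : Type*} [CommRing A] {f : A[X]} (hf : f.Monic) {Q : A} {g : A[X]}
    (hg : g.degree < f.degree)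
    (h : algebraMap A (AdjoinRoot f) Q ∣ AdjoinRoot.mk f g) : C Q ∣ g := by
  nontriviality A
  obtain ⟨y, hy⟩ := h
  obtain ⟨r, rfl⟩ := AdjoinRoot.mk_surjective y
  refine ⟨r %ₘ f, ?_⟩
  have hmod : g %ₘ f = (C Q * r) %ₘ f := by
    refine (modByMonic_eq_of_dvd_sub hf ?_)
    rw [← AdjoinRoot.mk_eq_zero, map_sub, map_mul, hy]
    exact sub_self _
  rw [← (modByMonic_eq_self_iff hf).2 hg, hmod, ← smul_eq_C_mul, smul_modByMonic, smul_eq_C_mul]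

end Reduced

theorem exists_mul_mem_range_of_finite_integralClosure (R K : Type*) [CommRing R] [CommRing K]
    [Algebra R K] [IsFractionRing R K] [Module.Finite R (integralClosure R K)] :
    ∃ D ∈ nonZeroDivisors R, ∀ o : integralClosure R K, ∃ r,
      algebraMap R (integralClosure R K) r = algebraMap R _ D * o := by
  have hfg : (Subalgebra.toSubmodule (integralClosure R K)).FG := Module.Finite.iff_fg.1 ‹_›
  obtain ⟨D, hD, h⟩ := FractionalIdeal.isFractional_of_fg (S := nonZeroDivisors R) hfg
  refine ⟨D, hD, fun o => (h o o.2).imp fun r hr => Subtype.ext ?_⟩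
  rw [← Algebra.smul_def]
  exact hr

section Curve

variable {k : Type*} [Field k] {f : k[X][X]} {P : k[X]}

/-- The irreducible polynomials `f` over `k[T]` with a unit as leading coefficient, for which
`k[T][x]/(f)` is an order in its fraction field, the coordinate ring of a plane curve. -/
structure IsCurve (f : k[X][X]) : Prop where
  isUnit_leadingCoeff : IsUnit f.leadingCoeff
  irreducible : Irreducible f

theorem map_span_singleton_adjoinRoot {A : Type*} [CommRing A] (f : A[X]) (P : A) :
    (Ideal.span {P}).map (algebraMap A (AdjoinRoot f)) =
      Ideal.span {algebraMap A (AdjoinRoot f) P} := by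
  rw [Ideal.map_span, Set.image_singleton]

theorem ker_adjoinRoot_mk {A : Type*} [CommRing A] (f : A[X]) :
    RingHom.ker (AdjoinRoot.mk f) = Ideal.span {f} := by
  ext g
  rw [RingHom.mem_ker, AdjoinRoot.mk_eq_zero, Ideal.mem_span_singleton]

theorem algHomOfDvd_mk {A : Type*} [CommRing A] {f g : A[X]} (h : g ∣ f) (r : A[X]) :
    AdjoinRoot.algHomOfDvd A f g h (AdjoinRoot.mk f r) = AdjoinRoot.mk g r := by
  rw [← AdjoinRoot.aeval_eq, ← AdjoinRoot.aeval_eq, ← aeval_algHom_apply,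
    AdjoinRoot.algHomOfDvd_root]

/-- The image of `P` in the completion of `k[T][x]/(f)` at `P`. -/
noncomputable def completedPrime (f : k[X][X]) (P : k[X]) : CompletedOrder f P :=
  algebraMap (AdjoinRoot f) (CompletedOrder f P) (algebraMap k[X] (AdjoinRoot f) P)

namespace IsCurve

theorem exists_monic (hf : IsCurve f) : ∃ g, g.Monic ∧ g.degree = f.degree ∧ Associated g f := by
  obtain ⟨u, hu⟩ := hf.isUnit_leadingCoeff
  refine ⟨C (↑u⁻¹ : k[X]) * f, ?_, degree_C_mul (Units.ne_zero _),
    (associated_isUnit_mul_left_iff (isUnit_C.2 u⁻¹.isUnit)).2 (Associated.refl f)⟩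
  rw [Monic, leadingCoeff_mul, leadingCoeff_C, ← hu, Units.inv_mul]

theorem isDomain (hf : IsCurve f) : IsDomain (AdjoinRoot f) :=
  AdjoinRoot.isDomain_of_prime hf.irreducible.prime

theorem degree_pos (hf : IsCurve f) : 0 < f.degree := by
  by_contra! h
  have hu := hf.isUnit_leadingCoeff
  rw [leadingCoeff, natDegree_eq_zero_iff_degree_le_zero.2 h, ← isUnit_C,
    ← eq_C_of_degree_le_zero h] at hu
  exact hf.irreducible.not_isUnit hu

theorem finite (hf : IsCurve f) : Module.Finite k[X] (AdjoinRoot f) := by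
  obtain ⟨g, hg, -, hgf⟩ := hf.exists_monic
  have := hg.finite_adjoinRoot
  refine .of_surjective (AdjoinRoot.algHomOfDvd k[X] g f hgf.symm.dvd).toLinearMap fun y => ?_
  obtain ⟨r, rfl⟩ := AdjoinRoot.mk_surjective y
  exact ⟨AdjoinRoot.mk g r, algHomOfDvd_mk hgf.symm.dvd r⟩

theorem injective_algebraMap (hf : IsCurve f) :
    Function.Injective (algebraMap k[X] (AdjoinRoot f)) :=
  AdjoinRoot.of.injective_of_degree_ne_zero hf.degree_pos.ne'

theorem exists_isReduced (hf : IsCurve f) {Q : k[X]} (hQ : Q ≠ 0) (g : k[X][X]) :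
    ∃ l, IsReduced f.natDegree Q.natDegree l ∧ ∃ u v, g = ofCoeffs₂ l + u * f + v * C Q := by
  obtain ⟨f', hf', hd, hff'⟩ := hf.exists_monic
  obtain ⟨w, hw⟩ := hff'.symm.dvd
  have hr : (g %ₘ f').degree < f.natDegree := by
    rw [← degree_eq_natDegree hf.irreducible.ne_zero, ← hd]
    exact degree_modByMonic_lt _ hf'
  obtain ⟨l, hl, v, hv⟩ := exists_isReduced_of_degree_lt hr hQ
  refine ⟨l, hl, w * (g /ₘ f'), v, ?_⟩
  linear_combination hv - modByMonic_add_div g f' + (g /ₘ f') * hw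

theorem eq_of_dvd_sub (hf : IsCurve f) {Q : k[X]} {n M : ℕ} (hn : n ≤ f.natDegree)
    (hM : M ≤ Q.natDegree) {l l' : List (List k)} (hl : IsReduced n M l) (hl' : IsReduced n M l')
    (h : algebraMap k[X] (AdjoinRoot f) Q ∣
      AdjoinRoot.mk f (ofCoeffs₂ l) - AdjoinRoot.mk f (ofCoeffs₂ l')) :
    ofCoeffs₂ l = ofCoeffs₂ l' := by
  obtain ⟨f', hf', hd, hff'⟩ := hf.exists_monic
  refine hl.eq_of_C_dvd_sub hM hl' (C_dvd_of_dvd_mk hf' ?_ ?_)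
  · rw [hd, degree_eq_natDegree hf.irreducible.ne_zero]
    exact (degree_sub_le _ _).trans_lt (max_lt (hl.degree_lt.trans_le (Nat.cast_le.2 hn))
      (hl'.degree_lt.trans_le (Nat.cast_le.2 hn)))
  · have := _root_.map_dvd (AdjoinRoot.algHomOfDvd k[X] f f' hff'.dvd) h
    rwa [AlgHom.commutes, ← map_sub, algHomOfDvd_mk] at this

theorem finite_quotient [Finite k] (hf : IsCurve f) {Q : k[X]} (hQ : Q ≠ 0) :
    Finite (AdjoinRoot f ⧸ Ideal.span {algebraMap k[X] (AdjoinRoot f) Q}) := by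
  have := (finite_isReduced (κ := k) f.natDegree Q.natDegree).to_subtype
  refine Finite.of_surjective (fun l : {l : List (List k) | IsReduced f.natDegree Q.natDegree l} =>
    Ideal.Quotient.mk _ (AdjoinRoot.mk f (ofCoeffs₂ l.1))) fun y => ?_
  obtain ⟨y, rfl⟩ := Ideal.Quotient.mk_surjective y
  obtain ⟨g, rfl⟩ := AdjoinRoot.mk_surjective y
  obtain ⟨l, hl, u, v, rfl⟩ := hf.exists_isReduced hQ g
  refine ⟨⟨l, hl⟩, ?_⟩
  rw [eq_comm, Ideal.Quotient.eq, Ideal.mem_span_singleton]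
  refine ⟨AdjoinRoot.mk f v, ?_⟩
  simp only [map_add, map_mul, AdjoinRoot.mk_self, AdjoinRoot.mk_C, AdjoinRoot.algebraMap_eq]
  ring

theorem finitelyComplete [Finite k] (hf : IsCurve f) (hP : P ≠ 0) :
    FinitelyComplete (completedPrime f P) := by
  have := hf.isDomain
  have := hf.finite_quotient hP
  rw [← map_span_singleton_adjoinRoot] at this
  refine adicCompletion_finitelyComplete (map_span_singleton_adjoinRoot f P)
    (mem_nonZeroDivisors_of_ne_zero ?_)
  rwa [Ne, map_eq_zero_iff _ hf.injective_algebraMap]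

theorem exists_dvd_algebraMap (hf : IsCurve f) {D : AdjoinRoot f} (hD : D ≠ 0) :
    ∃ a : k[X], a ≠ 0 ∧ D ∣ algebraMap k[X] (AdjoinRoot f) a := by
  have := hf.isDomain
  have := hf.finite
  have hcomap := Ideal.comap_ne_bot_of_integral_mem hD (Ideal.mem_span_singleton_self D)
    (Algebra.IsIntegral.isIntegral (R := k[X]) D)
  obtain ⟨a, ha, ha0⟩ := Submodule.exists_mem_ne_zero_of_ne_bot hcomap
  exact ⟨a, ha0, Ideal.mem_span_singleton.1 ha⟩

theorem exists_dvd_completedPrime_pow [Finite k] (hf : IsCurve f) (hP : Irreducible P)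
    {a : k[X]} (ha : a ≠ 0) : ∃ m, algebraMap (AdjoinRoot f) (CompletedOrder f P)
      (algebraMap k[X] (AdjoinRoot f) a) ∣ completedPrime f P ^ m := by
  obtain ⟨m, b, hb, rfl⟩ := WfDvdMonoid.max_power_factor ha hP
  obtain ⟨x, y, hxy⟩ := hP.coprime_iff_not_dvd.2 hb
  let φ := (algebraMap (AdjoinRoot f) (CompletedOrder f P)).comp (algebraMap k[X] (AdjoinRoot f))
  have hxy' : φ x * completedPrime f P + φ y * φ b = 1 := by
    have := congrArg φ hxy
    rwa [map_add, map_mul, map_mul, map_one] at this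
  have hb_unit : IsUnit (φ b) := by
    have := (hf.finitelyComplete hP.ne_zero).isUnit_one_add_mul (-φ x)
    rw [show 1 + completedPrime f P * -φ x = φ y * φ b by linear_combination -hxy'] at this
    exact isUnit_of_mul_isUnit_right this
  refine ⟨m, ?_⟩
  change φ (P ^ m * b) ∣ φ P ^ m
  rw [map_mul, map_pow]
  exact hb_unit.mul_right_dvd.2 dvd_rfl

theorem normalization [PerfectField k] (hf : IsCurve f) :
    IsDedekindDomain (integralClosure (AdjoinRoot f) (FractionRing (AdjoinRoot f))) ∧
      Module.Finite (AdjoinRoot f)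
        (integralClosure (AdjoinRoot f) (FractionRing (AdjoinRoot f))) := by
  have := hf.isDomain
  obtain ⟨g, hg, -, hgf⟩ := hf.exists_monic
  refine normalization_of_ker_eq_span_irreducible hg (hgf.irreducible_iff.2 hf.irreducible)
    AdjoinRoot.mk_surjective ?_
  rw [ker_adjoinRoot_mk, Ideal.span_singleton_eq_span_singleton]
  exact hgf.symm

theorem exists_pow_mem_sameClass [Finite k] (hf : IsCurve f) (hP : Irreducible P) :
    ∃ t, ∀ (I : Ideal (CompletedOrder f P)) (n : ℕ), completedPrime f P ^ n ∈ I →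
      ∃ L, completedPrime f P ^ t ∈ L ∧ SameClass I L := by
  have := hf.isDomain
  obtain ⟨_, _⟩ := hf.normalization
  obtain ⟨D, hD, hDO⟩ := exists_mul_mem_range_of_finite_integralClosure (AdjoinRoot f)
    (FractionRing (AdjoinRoot f))
  obtain ⟨a, ha, hDa⟩ := hf.exists_dvd_algebraMap (nonZeroDivisors.ne_zero hD)
  obtain ⟨m, hm⟩ := hf.exists_dvd_completedPrime_pow hP ha
  have hP0 : algebraMap k[X] (AdjoinRoot f) P ≠ 0 := by
    rw [Ne, map_eq_zero_iff _ hf.injective_algebraMap]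
    exact hP.ne_zero
  exact ⟨2 * m, fun I n hI => exists_pow_mem_sameClass_of_isDedekindDomain _
    (map_span_singleton_adjoinRoot f P) hP0 (hf.finitelyComplete hP.ne_zero) hDO
    ((_root_.map_dvd _ hDa).trans hm) hI⟩

end IsCurve

end Curve

section PrimitiveRecursion

variable {α β γ : Type*} [Primcodable α] [Primcodable β] [Primcodable γ]

attribute [fun_prop] Primrec
attribute [fun_prop] Primrec.id Primrec.const Primrec.comp

@[fun_prop]
theorem primrec_pair {f : α → β} {g : α → γ} (hf : Primrec f) (hg : Primrec g) :
    Primrec fun a => (f a, g a) := hf.pair hg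

@[fun_prop]
theorem primrec_fst {f : α → β × γ} (hf : Primrec f) : Primrec fun a => (f a).1 :=
  Primrec.fst.comp hf

@[fun_prop]
theorem primrec_snd {f : α → β × γ} (hf : Primrec f) : Primrec fun a => (f a).2 :=
  Primrec.snd.comp hf

@[fun_prop]
theorem primrec_add {f g : α → ℕ} (hf : Primrec f) (hg : Primrec g) :
    Primrec fun a => f a + g a := Primrec.nat_add.comp hf hg

@[fun_prop]
theorem primrec_mul {f g : α → ℕ} (hf : Primrec f) (hg : Primrec g) :
    Primrec fun a => f a * g a := Primrec.nat_mul.comp hf hg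

@[fun_prop]
theorem primrec_map {f : α → List β} {g : α → β → γ} (hf : Primrec f)
    (hg : Primrec fun x : α × β => g x.1 x.2) : Primrec fun a => (f a).map (g a) :=
  Primrec.list_map hf hg

@[fun_prop]
theorem primrec_flatMap {f : α → List β} {g : α → β → List γ} (hf : Primrec f)
    (hg : Primrec fun x : α × β => g x.1 x.2) : Primrec fun a => (f a).flatMap (g a) :=
  Primrec.list_flatMap hf hg

@[fun_prop]
theorem primrec_foldr {f : α → List β} {g : α → γ} {h : α → β → γ → γ} (hf : Primrec f)
    (hg : Primrec g) (hh : Primrec fun x : α × β × γ => h x.1 x.2.1 x.2.2) :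
    Primrec fun a => (f a).foldr (h a) (g a) :=
  (Primrec.list_foldr (h := fun a (x : β × γ) => h a x.1 x.2) hf hg hh).of_eq fun _ => rfl

@[fun_prop]
theorem primrec_range {f : α → ℕ} (hf : Primrec f) : Primrec fun a => List.range (f a) :=
  Primrec.list_range.comp hf

@[fun_prop]
theorem primrec_length {f : α → List β} (hf : Primrec f) : Primrec fun a => (f a).length :=
  Primrec.list_length.comp hf

@[fun_prop]
theorem primrec_cons {f : α → β} {g : α → List β} (hf : Primrec f) (hg : Primrec g) :
    Primrec fun a => f a :: g a := Primrec.list_cons.comp hf hg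

@[fun_prop]
theorem primrec_append {f g : α → List β} (hf : Primrec f) (hg : Primrec g) :
    Primrec fun a => f a ++ g a := Primrec.list_append.comp hf hg

@[fun_prop]
theorem primrec_getD {f : α → List β} {g : α → ℕ} (d : β) (hf : Primrec f) (hg : Primrec g) :
    Primrec fun a => (f a).getD (g a) d := (Primrec.list_getD d).comp hf hg

@[fun_prop]
theorem primrec_getElem? {f : α → List β} {g : α → ℕ} (hf : Primrec f) (hg : Primrec g) :
    Primrec fun a => (f a)[g a]? := Primrec.list_getElem?.comp hf hg

@[fun_prop]
theorem primrec_some {f : α → β} (hf : Primrec f) : Primrec fun a => some (f a) :=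
  Primrec.option_some.comp hf

theorem primrecPred_forall_mem {l : α → List β} {q : α → β → Prop} (hl : Primrec l)
    (hq : PrimrecPred fun x : α × β => q x.1 x.2) : PrimrecPred fun a => ∀ b ∈ l a, q a b := by
  have hq' : PrimrecRel fun (b : β) (a : α) => q a b :=
    hq.comp (Primrec.pair Primrec.snd Primrec.fst)
  exact hq'.forall_mem_list.comp hl Primrec.id

theorem primrecPred_exists_mem {l : α → List β} {q : α → β → Prop} (hl : Primrec l)
    (hq : PrimrecPred fun x : α × β => q x.1 x.2) : PrimrecPred fun a => ∃ b ∈ l a, q a b := by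
  have hq' : PrimrecRel fun (b : β) (a : α) => q a b :=
    hq.comp (Primrec.pair Primrec.snd Primrec.fst)
  exact hq'.exists_mem_list.comp hl Primrec.id

theorem primrecPred_eq {f g : α → β} (hf : Primrec f) (hg : Primrec g) :
    PrimrecPred fun a => f a = g a := Primrec.eq.comp hf hg

theorem primrecPred_le {f g : α → ℕ} (hf : Primrec f) (hg : Primrec g) :
    PrimrecPred fun a => f a ≤ g a := Primrec.nat_le.comp hf hg

theorem primrecPred_imp {p q : α → Prop} (hp : PrimrecPred p) (hq : PrimrecPred q) :
    PrimrecPred fun a => p a → q a := (hp.not.or hq).of_eq fun _ => imp_iff_not_or.symm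

theorem primrecPred_mem {f : α → β} {l : α → List β} (hf : Primrec f) (hl : Primrec l) :
    PrimrecPred fun a => f a ∈ l a :=
  (primrecPred_exists_mem hl (q := fun a b => b = f a)
    (primrecPred_eq Primrec.snd (hf.comp Primrec.fst))).of_eq fun a => by simp

theorem primrecPred_forall_lt {n : α → ℕ} {q : α → ℕ → Prop} (hn : Primrec n)
    (hq : PrimrecPred fun x : α × ℕ => q x.1 x.2) : PrimrecPred fun a => ∀ i < n a, q a i :=
  (primrecPred_forall_mem (Primrec.list_range.comp hn) hq).of_eq fun a => by simp

theorem primrecPred_exists_lt {n : α → ℕ} {q : α → ℕ → Prop} (hn : Primrec n)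
    (hq : PrimrecPred fun x : α × ℕ => q x.1 x.2) : PrimrecPred fun a => ∃ i < n a, q a i :=
  (primrecPred_exists_mem (Primrec.list_range.comp hn) hq).of_eq fun a => by simp

end PrimitiveRecursion

section ListArithmetic

variable {σ S : Type*} [Semiring S]

/-- Addition of coefficient lists, over a ring whose elements are encoded in `σ`. -/
def addList (z : σ) (add : σ → σ → σ) (a b : List σ) : List σ :=
  (List.range (a.length + b.length)).map fun i => add (a.getD i z) (b.getD i z)

/-- Multiplication of coefficient lists, over a ring whose elements are encoded in `σ`. -/
def mulList (z : σ) (add mul : σ → σ → σ) (a b : List σ) : List σ :=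
  a.foldr (fun x acc => addList z add (b.map fun y => mul x y) (z :: acc)) []

theorem getD_map_of_eq {φ : σ → S} {z : σ} (hz : φ z = 0) (l : List σ) (i : ℕ) :
    (l.map φ).getD i 0 = φ (l.getD i z) := by
  rw [← hz, List.getD_map]

theorem ofCoeffs_map_addList {φ : σ → S} {z : σ} {add : σ → σ → σ} (hz : φ z = 0)
    (hadd : ∀ x y, φ (add x y) = φ x + φ y) (a b : List σ) :
    ofCoeffs ((addList z add a b).map φ) = ofCoeffs (a.map φ) + ofCoeffs (b.map φ) := by
  ext i
  rw [coeff_add, coeff_ofCoeffs, coeff_ofCoeffs, coeff_ofCoeffs, getD_map_of_eq hz,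
    getD_map_of_eq hz, getD_map_of_eq hz, ← hadd]
  by_cases hi : i < a.length + b.length
  · simp [addList, List.getD_eq_getElem?_getD, hi]
  · rw [List.getD_eq_default _ _ (by simpa [addList] using hi), hadd,
      List.getD_eq_default a _ (by lia), List.getD_eq_default b _ (by lia), hz, add_zero]

theorem ofCoeffs_map_mulList {φ : σ → S} {z : σ} {add mul : σ → σ → σ} (hz : φ z = 0)
    (hadd : ∀ x y, φ (add x y) = φ x + φ y) (hmul : ∀ x y, φ (mul x y) = φ x * φ y)
    (a b : List σ) :
    ofCoeffs ((mulList z add mul a b).map φ) = ofCoeffs (a.map φ) * ofCoeffs (b.map φ) := by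
  induction a with
  | nil => simp [mulList, ofCoeffs]
  | cons x a ih =>
    have hsmul : ofCoeffs ((b.map fun y => mul x y).map φ) =
        C (φ x) * ofCoeffs (b.map φ) := by
      ext i
      rw [coeff_C_mul, coeff_ofCoeffs, coeff_ofCoeffs, List.map_map]
      by_cases hi : i < b.length
      · simp [List.getD_eq_getElem?_getD, hi, hmul]
      · rw [List.getD_eq_default _ _ (by simpa using hi),
          List.getD_eq_default _ _ (by simpa using hi), mul_zero]
    rw [mulList, List.foldr_cons, ofCoeffs_map_addList hz hadd, hsmul]
    change _ + (C (φ z) + X * ofCoeffs ((mulList z add mul a b).map φ)) =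
      (C (φ x) + X * ofCoeffs (a.map φ)) * _
    rw [ih, hz, C_0, zero_add, add_mul, mul_assoc]

theorem ofCoeffs_map_eq_iff {φ : σ → S} {z : σ} (hz : φ z = 0) (a b : List σ) :
    ofCoeffs (a.map φ) = ofCoeffs (b.map φ) ↔
      ∀ i < a.length + b.length, φ (a.getD i z) = φ (b.getD i z) := by
  rw [ext_iff]
  simp only [coeff_ofCoeffs, getD_map_of_eq hz]
  refine ⟨fun h i _ => h i, fun h i => ?_⟩
  by_cases hi : i < a.length + b.length
  · exact h i hi
  · rw [List.getD_eq_default a _ (by lia), List.getD_eq_default b _ (by lia)]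

variable {α : Type*} [Primcodable α] [Primcodable σ]

theorem primrec_addList {z : σ} {add : σ → σ → σ} (hadd : Primrec₂ add) {f g : α → List σ}
    (hf : Primrec f) (hg : Primrec g) : Primrec fun a => addList z add (f a) (g a) := by
  unfold addList
  refine primrec_map (by fun_prop) (hadd.comp (by fun_prop) (by fun_prop))

theorem primrec_mulList {z : σ} {add mul : σ → σ → σ} (hadd : Primrec₂ add) (hmul : Primrec₂ mul)
    {f g : α → List σ} (hf : Primrec f) (hg : Primrec g) :
    Primrec fun a => mulList z add mul (f a) (g a) := by
  unfold mulList
  refine primrec_foldr hf (by fun_prop) (primrec_addList hadd ?_ (by fun_prop))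
  exact primrec_map (by fun_prop) (hmul.comp (by fun_prop) (by fun_prop))

theorem primrecPred_ofCoeffs_map_eq {φ : σ → S} {z : σ} (hz : φ z = 0)
    (h : PrimrecRel fun x y => φ x = φ y) {f g : α → List σ} (hf : Primrec f) (hg : Primrec g) :
    PrimrecPred fun a => ofCoeffs ((f a).map φ) = ofCoeffs ((g a).map φ) := by
  simp only [ofCoeffs_map_eq_iff hz]
  exact primrecPred_forall_lt (by fun_prop) (h.comp (by fun_prop) (by fun_prop))

end ListArithmetic

section BivariateArithmetic

variable {k : Type*} [Field k]

/-- Addition of coefficient lists over `k`. -/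
def addCoeffs (a b : List k) : List k := addList 0 (fun x y => x + y) a b

/-- Multiplication of coefficient lists over `k`. -/
def mulCoeffs (a b : List k) : List k := mulList 0 (fun x y => x + y) (fun x y => x * y) a b

/-- Powers of coefficient lists over `k`. -/
def powCoeffs (a : List k) (n : ℕ) : List k := (List.range n).foldr (fun _ b => mulCoeffs a b) [1]

/-- Addition of coefficient lists over `k[X]`. -/
def addCoeffs₂ (a b : List (List k)) : List (List k) := addList [] addCoeffs a b

/-- Multiplication of coefficient lists over `k[X]`. -/
def mulCoeffs₂ (a b : List (List k)) : List (List k) := mulList [] addCoeffs mulCoeffs a b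

theorem ofCoeffs_addCoeffs (a b : List k) :
    ofCoeffs (addCoeffs a b) = ofCoeffs a + ofCoeffs b := by
  simpa [addCoeffs] using ofCoeffs_map_addList (φ := (id : k → k)) rfl (fun _ _ => rfl) a b

theorem ofCoeffs_mulCoeffs (a b : List k) :
    ofCoeffs (mulCoeffs a b) = ofCoeffs a * ofCoeffs b := by
  simpa [mulCoeffs] using ofCoeffs_map_mulList (φ := (id : k → k)) rfl (fun _ _ => rfl)
    (fun _ _ => rfl) a b

theorem ofCoeffs_powCoeffs (a : List k) (n : ℕ) : ofCoeffs (powCoeffs a n) = ofCoeffs a ^ n := by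
  have ofCoeffs_foldr (l : List ℕ) :
      ofCoeffs (l.foldr (fun _ b => mulCoeffs a b) [1]) = ofCoeffs a ^ l.length := by
    induction l with
    | nil => simp [ofCoeffs]
    | cons x l ih => rw [List.foldr_cons, ofCoeffs_mulCoeffs, ih, List.length_cons, pow_succ']
  rw [powCoeffs, ofCoeffs_foldr, List.length_range]

theorem ofCoeffs₂_addCoeffs₂ (a b : List (List k)) :
    ofCoeffs₂ (addCoeffs₂ a b) = ofCoeffs₂ a + ofCoeffs₂ b :=
  ofCoeffs_map_addList (φ := ofCoeffs) (z := []) rfl ofCoeffs_addCoeffs a b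

theorem ofCoeffs₂_mulCoeffs₂ (a b : List (List k)) :
    ofCoeffs₂ (mulCoeffs₂ a b) = ofCoeffs₂ a * ofCoeffs₂ b :=
  ofCoeffs_map_mulList (φ := ofCoeffs) (z := []) rfl ofCoeffs_addCoeffs ofCoeffs_mulCoeffs a b

theorem ofCoeffs₂_singleton (a : List k) : ofCoeffs₂ [a] = C (ofCoeffs a) := by
  simp [ofCoeffs₂, ofCoeffs]

theorem ofCoeffs_surjective {S : Type*} [Semiring S] :
    Function.Surjective (ofCoeffs : List S → S[X]) := fun a =>
  ⟨_, ofCoeffs_map_range (degree_lt_iff_coeff_zero _ _ |>.2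
    fun i (hi : a.natDegree + 1 ≤ i) => coeff_eq_zero_of_natDegree_lt hi)⟩

theorem ofCoeffs₂_surjective : Function.Surjective (ofCoeffs₂ : List (List k) → k[X][X]) :=
  ofCoeffs_surjective.comp (List.map_surjective_iff.2 ofCoeffs_surjective)

variable [Primcodable k] {α : Type*} [Primcodable α]

theorem primrecPred_ofCoeffs₂_eq {f g : α → List (List k)} (hf : Primrec f) (hg : Primrec g) :
    PrimrecPred fun a => ofCoeffs₂ (f a) = ofCoeffs₂ (g a) := by
  refine primrecPred_ofCoeffs_map_eq (φ := ofCoeffs) (z := []) rfl ?_ hf hg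
  rw [PrimrecRel]
  simpa only [List.map_id] using primrecPred_ofCoeffs_map_eq (φ := (id : k → k)) (z := 0) rfl
    Primrec.eq (Primrec.fst (α := List k) (β := List k)) Primrec.snd

variable [Finite k]

@[fun_prop]
theorem primrec_addCoeffs {f g : α → List k} (hf : Primrec f) (hg : Primrec g) :
    Primrec fun a => addCoeffs (f a) (g a) := primrec_addList (Primrec.dom_finite _) hf hg

@[fun_prop]
theorem primrec_mulCoeffs {f g : α → List k} (hf : Primrec f) (hg : Primrec g) :
    Primrec fun a => mulCoeffs (f a) (g a) :=
  primrec_mulList (Primrec.dom_finite _) (Primrec.dom_finite _) hf hg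

@[fun_prop]
theorem primrec_powCoeffs {f : α → List k} {n : α → ℕ} (hf : Primrec f) (hn : Primrec n) :
    Primrec fun a => powCoeffs (f a) (n a) := by
  unfold powCoeffs
  fun_prop

@[fun_prop]
theorem primrec_addCoeffs₂ {f g : α → List (List k)} (hf : Primrec f) (hg : Primrec g) :
    Primrec fun a => addCoeffs₂ (f a) (g a) :=
  primrec_addList (primrec_addCoeffs Primrec.fst Primrec.snd) hf hg

@[fun_prop]
theorem primrec_mulCoeffs₂ {f g : α → List (List k)} (hf : Primrec f) (hg : Primrec g) :
    Primrec fun a => mulCoeffs₂ (f a) (g a) :=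
  primrec_mulList (primrec_addCoeffs Primrec.fst Primrec.snd)
    (primrec_mulCoeffs Primrec.fst Primrec.snd) hf hg

end BivariateArithmetic

section Subsets

variable {σ : Type*} [Primcodable σ] {α : Type*} [Primcodable α]

@[fun_prop]
theorem primrec_sublists {f : α → List σ} (hf : Primrec f) : Primrec fun a => (f a).sublists := by
  unfold List.sublists
  fun_prop

end Subsets

section Certificates

variable {k : Type*} [Field k]

/-- The data of a finite model of `k[T][x]/(f, P ^ N)`: the coefficients of `f` and `P`; numbers
`t`, `n` and `d`, of which `t` determines `N` and the two others bound the degrees of `f` and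
`P`; the elements of the model; and the multipliers of `f` and `P ^ N` that are used in reductions
to these elements. This is a nested product, not a structure, because `Primcodable` instances exist
for products and lists. -/
abbrev ModelData (k : Type*) :=
  (List (List k) × List k) × (ℕ × ℕ × ℕ) × List (List (List k)) ×
    List (List (List k) × List (List k))

namespace ModelData

/-- The coefficients of `f`. -/
abbrev poly (M : ModelData k) : List (List k) := M.1.1

/-- The coefficients of `P`. -/
abbrev prime (M : ModelData k) : List k := M.1.2

/-- All ideals of the list of representatives contain `P ^ t`. -/
abbrev level (M : ModelData k) : ℕ := M.2.1.1

/-- All ideals under consideration contain `P ^ m`. -/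
abbrev idealLevel (M : ModelData k) : ℕ := 2 * M.level + 1

/-- The exponent `N` of the modulus `P ^ N`. -/
abbrev precision (M : ModelData k) : ℕ := 2 * M.idealLevel + 1

/-- A lower bound of the degree of `f`. -/
abbrev polyDeg (M : ModelData k) : ℕ := M.2.1.2.1

/-- A lower bound of the degree of `P`. -/
abbrev primeDeg (M : ModelData k) : ℕ := M.2.1.2.2

/-- The elements of the model. -/
abbrev elems (M : ModelData k) : List (List (List k)) := M.2.2.1

/-- The multipliers for reductions. -/
abbrev mults (M : ModelData k) : List (List (List k) × List (List k)) := M.2.2.2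

/-- The power `P ^ i`. -/
def primePow (M : ModelData k) (i : ℕ) : List (List k) := [powCoeffs M.prime i]

/-- The polynomial `a` is reduced to `e` by one of the multipliers. -/
def ReducesTo (M : ModelData k) (a e : List (List k)) : Prop :=
  ∃ w ∈ M.mults, ofCoeffs₂ a = ofCoeffs₂ (addCoeffs₂ e
    (addCoeffs₂ (mulCoeffs₂ w.1 M.poly) (mulCoeffs₂ w.2 (M.primePow M.precision))))

/-- The polynomial `a` is reduced to an element of the model. -/
def Reducible (M : ModelData k) (a : List (List k)) : Prop := ∃ e ∈ M.elems, M.ReducesTo a e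

/-- The polynomials `a` and `b` are reduced to the same element of the model. -/
def Congr (M : ModelData k) (a b : List (List k)) : Prop :=
  ∃ e ∈ M.elems, M.ReducesTo a e ∧ M.ReducesTo b e

/-- The polynomials that have to be reducible. For sums, products, constants, `T` and `x` this makes
every element of `k[T][x]/(f, P ^ N)` the value of an element of the model; the other entries occur
in the comparisons of ideals below. -/
def required (κ : List k) (M : ModelData k) : List (List (List k)) :=
  M.elems ++ (M.elems.flatMap fun a => M.elems.map fun b => addCoeffs₂ a b) ++
    (M.elems.flatMap fun a => M.elems.map fun b => mulCoeffs₂ a b) ++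
    ((List.range M.precision).map fun i => M.primePow i) ++
    ((List.range M.precision).flatMap fun i => M.elems.map fun b => mulCoeffs₂ (M.primePow i) b) ++
    (κ.map fun c => [[c]]) ++ [[[0, 1]], [[], [1]]]

/-- The data describe `k[T][x]/(f, P ^ N)`; here `κ` is the list of all elements of `k`. -/
def IsModel (κ : List k) (M : ModelData k) : Prop :=
  M.prime.getD M.primeDeg 0 ≠ 0 ∧ (∃ c ∈ M.poly.getD M.polyDeg [], c ≠ 0) ∧
    (∀ e ∈ M.elems, IsReduced M.polyDeg (M.primeDeg * M.precision) e) ∧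
    ∀ a ∈ M.required κ, M.Reducible a

/-- The list consists of the elements of an ideal that contains `P ^ m`. -/
def IsIdeal (M : ModelData k) (L : List (List (List k))) : Prop :=
  (∀ a ∈ L, a ∈ M.elems) ∧ (∃ a ∈ L, M.Congr a (M.primePow M.idealLevel)) ∧
    (∀ a ∈ L, ∀ b ∈ L, ∃ c ∈ L, M.Congr (addCoeffs₂ a b) c) ∧
    ∀ a ∈ M.elems, ∀ b ∈ L, ∃ c ∈ L, M.Congr (mulCoeffs₂ a b) c

/-- Two ideals are in the same class. -/
def Equivalent (M : ModelData k) (L L' : List (List (List k))) : Prop :=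
  ∃ y ∈ M.elems, ∃ z ∈ M.elems, M.Congr (mulCoeffs₂ y z) (M.primePow (2 * M.idealLevel)) ∧
    (∀ a ∈ L, ∃ b ∈ L', M.Congr (mulCoeffs₂ y a) (mulCoeffs₂ (M.primePow M.idealLevel) b)) ∧
    ∀ b ∈ L', ∃ a ∈ L, M.Congr (mulCoeffs₂ z b) (mulCoeffs₂ (M.primePow M.idealLevel) a)

/-- An ideal contains the product of two others. -/
def ContainsProduct (M : ModelData k) (J L L' : List (List (List k))) : Prop :=
  ∀ a ∈ L, ∀ b ∈ L', ∃ c ∈ J, M.Congr (mulCoeffs₂ a b) c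

/-- One ideal is contained in another. -/
def Contained (M : ModelData k) (J J' : List (List (List k))) : Prop :=
  ∀ a ∈ J, ∃ b ∈ J', M.Congr a b

/-- The ideal `J` is the product of `L` and `L'`. -/
def IsProduct (M : ModelData k) (J L L' : List (List (List k))) : Prop :=
  M.IsIdeal J ∧ M.ContainsProduct J L L' ∧
    ∀ J' ∈ M.elems.sublists, M.IsIdeal J' → M.ContainsProduct J' L L' → M.Contained J J'

/-- The output consists of ideals of the model which represent every class exactly once, and the
multiplication table of the classes. That every class is represented is expressed by a closure
property: the unit ideal is equivalent to a member of the list, and so is every ideal `J` with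
`P L ⊆ J ⊆ L` for a member `L`. -/
def Certifies (M : ModelData k) (out : List (List (List (List k))) × List (List ℕ)) : Prop :=
  (∀ L ∈ out.1, M.IsIdeal L ∧ ∃ a ∈ L, M.Congr a (M.primePow M.level)) ∧
    (∀ i < out.1.length, ∀ j < out.1.length, M.Equivalent (out.1.getD i []) (out.1.getD j []) →
      i = j) ∧
    (∃ L ∈ out.1, M.Equivalent L M.elems) ∧
    (∀ L ∈ out.1, ∀ J ∈ M.elems.sublists, M.IsIdeal J → M.Contained J L →
      (∀ a ∈ L, ∃ b ∈ J, M.Congr (mulCoeffs₂ (M.primePow 1) a) b) →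
      ∃ L' ∈ out.1, M.Equivalent L' J) ∧
    ∀ i < out.1.length, ∀ j < out.1.length, ∃ r < out.1.length,
      (out.2.getD i [])[j]? = some r ∧ ∃ J ∈ M.elems.sublists,
        M.IsProduct J (out.1.getD i []) (out.1.getD j []) ∧ M.Equivalent (out.1.getD r []) J

section PrimitiveRecursive

variable [Finite k] [Primcodable k] {α : Type*} [Primcodable α] {M : α → ModelData k}

@[fun_prop]
theorem primrec_primePow (hM : Primrec M) {i : α → ℕ} (hi : Primrec i) :
    Primrec fun x => (M x).primePow (i x) := by
  unfold primePow
  fun_prop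

theorem primrecPred_reducesTo (hM : Primrec M) {a e : α → List (List k)} (ha : Primrec a)
    (he : Primrec e) : PrimrecPred fun x => (M x).ReducesTo (a x) (e x) := by
  unfold ReducesTo
  refine primrecPred_exists_mem (by fun_prop) (primrecPred_ofCoeffs₂_eq ?_ ?_) <;> fun_prop

theorem primrecPred_reducible (hM : Primrec M) {a : α → List (List k)} (ha : Primrec a) :
    PrimrecPred fun x => (M x).Reducible (a x) := by
  unfold Reducible
  refine primrecPred_exists_mem (by fun_prop) (primrecPred_reducesTo ?_ ?_ ?_) <;> fun_prop

theorem primrecPred_congr (hM : Primrec M) {a b : α → List (List k)} (ha : Primrec a)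
    (hb : Primrec b) : PrimrecPred fun x => (M x).Congr (a x) (b x) := by
  unfold Congr
  refine primrecPred_exists_mem (by fun_prop) (.and (primrecPred_reducesTo ?_ ?_ ?_)
    (primrecPred_reducesTo ?_ ?_ ?_)) <;> fun_prop

theorem primrecPred_isModel (κ : List k) : PrimrecPred fun M : ModelData k => M.IsModel κ := by
  unfold IsModel IsReduced
  refine .and (.not (primrecPred_eq (by fun_prop) (by fun_prop))) (.and ?_ (.and ?_ ?_))
  · exact primrecPred_exists_mem (by fun_prop) (.not (primrecPred_eq (by fun_prop) (by fun_prop)))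
  · refine primrecPred_forall_mem (by fun_prop) (.and (primrecPred_le (by fun_prop) (by fun_prop))
      (primrecPred_forall_mem (by fun_prop) (primrecPred_le ?_ ?_))) <;> fun_prop
  · refine primrecPred_forall_mem ?_ (primrecPred_reducible Primrec.fst Primrec.snd)
    unfold required
    fun_prop

theorem primrecPred_isIdeal (hM : Primrec M) {L : α → List (List (List k))} (hL : Primrec L) :
    PrimrecPred fun x => (M x).IsIdeal (L x) := by
  unfold IsIdeal
  refine .and ?_ (.and ?_ (.and ?_ ?_))
  · exact primrecPred_forall_mem hL (primrecPred_mem (by fun_prop) (by fun_prop))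
  · refine primrecPred_exists_mem hL (primrecPred_congr ?_ ?_ ?_) <;> fun_prop
  · refine primrecPred_forall_mem hL (primrecPred_forall_mem (by fun_prop)
      (primrecPred_exists_mem (by fun_prop) (primrecPred_congr ?_ ?_ ?_))) <;> fun_prop
  · refine primrecPred_forall_mem (by fun_prop) (primrecPred_forall_mem (by fun_prop)
      (primrecPred_exists_mem (by fun_prop) (primrecPred_congr ?_ ?_ ?_))) <;> fun_prop

theorem primrecPred_equivalent (hM : Primrec M) {L L' : α → List (List (List k))}
    (hL : Primrec L) (hL' : Primrec L') : PrimrecPred fun x => (M x).Equivalent (L x) (L' x) := by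
  unfold Equivalent
  refine primrecPred_exists_mem (by fun_prop) (primrecPred_exists_mem (by fun_prop)
    (.and ?_ (.and ?_ ?_)))
  · refine primrecPred_congr ?_ ?_ ?_ <;> fun_prop
  all_goals
    refine primrecPred_forall_mem (by fun_prop) (primrecPred_exists_mem (by fun_prop)
      (primrecPred_congr ?_ ?_ ?_)) <;> fun_prop

theorem primrecPred_containsProduct (hM : Primrec M) {J L L' : α → List (List (List k))}
    (hJ : Primrec J) (hL : Primrec L) (hL' : Primrec L') :
    PrimrecPred fun x => (M x).ContainsProduct (J x) (L x) (L' x) := by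
  unfold ContainsProduct
  refine primrecPred_forall_mem (by fun_prop) (primrecPred_forall_mem (by fun_prop)
      (primrecPred_exists_mem (by fun_prop) (primrecPred_congr ?_ ?_ ?_))) <;> fun_prop

theorem primrecPred_contained (hM : Primrec M) {J J' : α → List (List (List k))}
    (hJ : Primrec J) (hJ' : Primrec J') :
    PrimrecPred fun x => (M x).Contained (J x) (J' x) := by
  unfold Contained
  refine primrecPred_forall_mem (by fun_prop)
      (primrecPred_exists_mem (by fun_prop) (primrecPred_congr ?_ ?_ ?_)) <;> fun_prop

theorem primrecPred_isProduct (hM : Primrec M) {J L L' : α → List (List (List k))}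
    (hJ : Primrec J) (hL : Primrec L) (hL' : Primrec L') :
    PrimrecPred fun x => (M x).IsProduct (J x) (L x) (L' x) := by
  unfold IsProduct
  refine .and (primrecPred_isIdeal hM hJ) (.and (primrecPred_containsProduct hM hJ hL hL') ?_)
  refine primrecPred_forall_mem (by fun_prop) (primrecPred_imp (primrecPred_isIdeal ?_ ?_)
    (primrecPred_imp (primrecPred_containsProduct ?_ ?_ ?_ ?_)
      (primrecPred_contained ?_ ?_ ?_))) <;> fun_prop

theorem primrecPred_certifies : PrimrecPred fun x : ModelData k ×
    List (List (List (List k))) × List (List ℕ) => x.1.Certifies x.2 := by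
  unfold Certifies
  refine .and ?_ (.and ?_ (.and ?_ (.and ?_ ?_)))
  · refine primrecPred_forall_mem (by fun_prop) (.and (primrecPred_isIdeal ?_ ?_)
      (primrecPred_exists_mem ?_ (primrecPred_congr ?_ ?_ ?_))) <;> fun_prop
  · refine primrecPred_forall_lt (by fun_prop) (primrecPred_forall_lt (by fun_prop)
      (primrecPred_imp (primrecPred_equivalent ?_ ?_ ?_) (primrecPred_eq ?_ ?_))) <;> fun_prop
  · refine primrecPred_exists_mem (by fun_prop) (primrecPred_equivalent ?_ ?_ ?_) <;> fun_prop
  · refine primrecPred_forall_mem (by fun_prop) (primrecPred_forall_mem (by fun_prop)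
      (primrecPred_imp (primrecPred_isIdeal ?_ ?_) (primrecPred_imp (primrecPred_contained ?_ ?_ ?_)
        (primrecPred_imp (primrecPred_forall_mem ?_ (primrecPred_exists_mem ?_
          (primrecPred_congr ?_ ?_ ?_))) (primrecPred_exists_mem ?_
            (primrecPred_equivalent ?_ ?_ ?_)))))) <;> fun_prop
  · refine primrecPred_forall_lt (by fun_prop) (primrecPred_forall_lt (by fun_prop)
      (primrecPred_exists_lt (by fun_prop) (.and (primrecPred_eq ?_ ?_)
        (primrecPred_exists_mem ?_ (.and (primrecPred_isProduct ?_ ?_ ?_ ?_)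
          (primrecPred_equivalent ?_ ?_ ?_)))))) <;> fun_prop

end PrimitiveRecursive

end ModelData
end Certificates

section Models

variable {k : Type*} [Field k] {Q : Type*} [CommRing Q]

namespace ModelData

/-- The map `ρ` identifies the finite model `M` with the ring `Q`: every element of `Q` is the value
of an element of the model, and for the polynomials that occur in the computations the formal
congruence of the model is equality in `Q`. -/
structure Realizes (M : ModelData k) (ρ : k[X][X] →+* Q) : Prop where
  congr_iff : ∀ {a b}, M.Reducible a → M.Reducible b →
    (M.Congr a b ↔ ρ (ofCoeffs₂ a) = ρ (ofCoeffs₂ b))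
  exists_elem : ∀ s, ∃ e ∈ M.elems, ρ (ofCoeffs₂ e) = s
  reducible : ∀ a ∈ M.elems, M.Reducible a
  reducible_add : ∀ a ∈ M.elems, ∀ b ∈ M.elems, M.Reducible (addCoeffs₂ a b)
  reducible_mul : ∀ a ∈ M.elems, ∀ b ∈ M.elems, M.Reducible (mulCoeffs₂ a b)
  reducible_primePow : ∀ i < M.precision, M.Reducible (M.primePow i)
  reducible_primePow_mul : ∀ i < M.precision, ∀ b ∈ M.elems,
    M.Reducible (mulCoeffs₂ (M.primePow i) b)

/-- The members of the list `L` are elements of the model, and their values in `Q` are the elements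
of the ideal `I`. -/
def Lists (M : ModelData k) (ρ : k[X][X] →+* Q) (L : List (List (List k))) (I : Ideal Q) : Prop :=
  (∀ a ∈ L, a ∈ M.elems) ∧ ∀ s, s ∈ I ↔ ∃ a ∈ L, ρ (ofCoeffs₂ a) = s

variable {M : ModelData k} {ρ : k[X][X] →+* Q} {a b c : List (List k)} {i : ℕ}
  {J L L' : List (List (List k))} {I I' K : Ideal Q}

theorem ofCoeffs₂_primePow (M : ModelData k) (i : ℕ) :
    ofCoeffs₂ (M.primePow i) = C (ofCoeffs M.prime) ^ i := by
  rw [primePow, ofCoeffs₂_singleton, ofCoeffs_powCoeffs, C_pow]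

namespace Lists

theorem forall_mem_iff (hL : M.Lists ρ L I) {q : Q → Prop} :
    (∀ s ∈ I, q s) ↔ ∀ a ∈ L, q (ρ (ofCoeffs₂ a)) := by
  simp [hL.2]

theorem exists_mem_iff (hL : M.Lists ρ L I) {q : Q → Prop} :
    (∃ s ∈ I, q s) ↔ ∃ a ∈ L, q (ρ (ofCoeffs₂ a)) := by
  simp [hL.2]

end Lists

namespace Realizes

theorem congr_primePow_iff (h : M.Realizes ρ) (ha : a ∈ M.elems) (hi : i < M.precision) :
    M.Congr a (M.primePow i) ↔ ρ (ofCoeffs₂ a) = ρ (C (ofCoeffs M.prime)) ^ i := by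
  rw [h.congr_iff (h.reducible a ha) (h.reducible_primePow i hi), ofCoeffs₂_primePow, map_pow]

theorem congr_add_iff (h : M.Realizes ρ) (ha : a ∈ M.elems) (hb : b ∈ M.elems)
    (hc : c ∈ M.elems) :
    M.Congr (addCoeffs₂ a b) c ↔ ρ (ofCoeffs₂ a) + ρ (ofCoeffs₂ b) = ρ (ofCoeffs₂ c) := by
  rw [h.congr_iff (h.reducible_add a ha b hb) (h.reducible c hc), ofCoeffs₂_addCoeffs₂, map_add]

theorem congr_mul_iff (h : M.Realizes ρ) (ha : a ∈ M.elems) (hb : b ∈ M.elems)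
    (hc : c ∈ M.elems) :
    M.Congr (mulCoeffs₂ a b) c ↔ ρ (ofCoeffs₂ a) * ρ (ofCoeffs₂ b) = ρ (ofCoeffs₂ c) := by
  rw [h.congr_iff (h.reducible_mul a ha b hb) (h.reducible c hc), ofCoeffs₂_mulCoeffs₂, map_mul]

theorem congr_mul_primePow_iff (h : M.Realizes ρ) (ha : a ∈ M.elems) (hb : b ∈ M.elems)
    (hi : i < M.precision) : M.Congr (mulCoeffs₂ a b) (M.primePow i) ↔
      ρ (ofCoeffs₂ a) * ρ (ofCoeffs₂ b) = ρ (C (ofCoeffs M.prime)) ^ i := by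
  rw [h.congr_iff (h.reducible_mul a ha b hb) (h.reducible_primePow i hi), ofCoeffs₂_mulCoeffs₂,
    ofCoeffs₂_primePow, map_mul, map_pow]

theorem congr_mul_primePow_mul_iff (h : M.Realizes ρ) (ha : a ∈ M.elems) (hb : b ∈ M.elems)
    (hc : c ∈ M.elems) (hi : i < M.precision) :
    M.Congr (mulCoeffs₂ a b) (mulCoeffs₂ (M.primePow i) c) ↔
      ρ (ofCoeffs₂ a) * ρ (ofCoeffs₂ b) = ρ (C (ofCoeffs M.prime)) ^ i * ρ (ofCoeffs₂ c) := by
  rw [h.congr_iff (h.reducible_mul a ha b hb) (h.reducible_primePow_mul i hi c hc),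
    ofCoeffs₂_mulCoeffs₂, ofCoeffs₂_mulCoeffs₂, ofCoeffs₂_primePow, map_mul, map_mul, map_pow]

theorem congr_primePow_mul_iff (h : M.Realizes ρ) (ha : a ∈ M.elems) (hb : b ∈ M.elems)
    (hi : i < M.precision) : M.Congr (mulCoeffs₂ (M.primePow i) a) b ↔
      ρ (C (ofCoeffs M.prime)) ^ i * ρ (ofCoeffs₂ a) = ρ (ofCoeffs₂ b) := by
  rw [h.congr_iff (h.reducible_primePow_mul i hi a ha) (h.reducible b hb), ofCoeffs₂_mulCoeffs₂,
    ofCoeffs₂_primePow, map_mul, map_pow]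

theorem lists_elems (h : M.Realizes ρ) : M.Lists ρ M.elems ⊤ :=
  ⟨fun _ ha => ha, fun s => iff_of_true Submodule.mem_top (h.exists_elem s)⟩

theorem exists_iff (h : M.Realizes ρ) {q : Q → Prop} :
    (∃ s, q s) ↔ ∃ e ∈ M.elems, q (ρ (ofCoeffs₂ e)) := by
  simpa using h.lists_elems.exists_mem_iff (q := q)

theorem exists_lists (h : M.Realizes ρ) (I : Ideal Q) :
    ∃ L ∈ M.elems.sublists, M.Lists ρ L I := by
  classical
  refine ⟨M.elems.filter fun e => ρ (ofCoeffs₂ e) ∈ I, List.mem_sublists.2 List.filter_sublist,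
    fun a ha => List.mem_of_mem_filter ha, fun s => ?_⟩
  obtain ⟨e, he, rfl⟩ := h.exists_elem s
  simp only [List.mem_filter, decide_eq_true_eq]
  exact ⟨fun hs => ⟨e, ⟨he, hs⟩, rfl⟩, fun ⟨_, ⟨_, ha⟩, hae⟩ => hae ▸ ha⟩

theorem exists_lists_of_isIdeal (h : M.Realizes ρ) (hL : M.IsIdeal L) : ∃ I, M.Lists ρ L I := by
  obtain ⟨hE, ⟨a₀, ha₀, -⟩, hadd, hmul⟩ := hL
  have smul_mem : ∀ r, ∀ a ∈ L, ∃ c ∈ L, ρ (ofCoeffs₂ c) = r * ρ (ofCoeffs₂ a) := by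
    intro r a ha
    obtain ⟨e, he, rfl⟩ := h.exists_elem r
    obtain ⟨c, hc, heac⟩ := hmul e he a ha
    exact ⟨c, hc, ((h.congr_mul_iff he (hE a ha) (hE c hc)).1 heac).symm⟩
  let I : Ideal Q :=
    { carrier := {s | ∃ a ∈ L, ρ (ofCoeffs₂ a) = s}
      add_mem' := by
        rintro _ _ ⟨a, ha, rfl⟩ ⟨b, hb, rfl⟩
        obtain ⟨c, hc, habc⟩ := hadd a ha b hb
        exact ⟨c, hc, ((h.congr_add_iff (hE a ha) (hE b hb) (hE c hc)).1 habc).symm⟩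
      zero_mem' := by simpa using smul_mem 0 a₀ ha₀
      smul_mem' := by
        rintro r _ ⟨a, ha, rfl⟩
        exact smul_mem r a ha }
  exact ⟨I, hE, fun s => Iff.rfl⟩

theorem exists_congr_primePow_iff (h : M.Realizes ρ) (hL : M.Lists ρ L I) (hi : i < M.precision) :
    (∃ a ∈ L, M.Congr a (M.primePow i)) ↔ ρ (C (ofCoeffs M.prime)) ^ i ∈ I := by
  rw [hL.2]
  exact exists_congr fun a => and_congr_right fun ha => h.congr_primePow_iff (hL.1 a ha) hi

theorem isIdeal_iff (h : M.Realizes ρ) (hL : M.Lists ρ L I) :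
    M.IsIdeal L ↔ ρ (C (ofCoeffs M.prime)) ^ M.idealLevel ∈ I := by
  rw [← h.exists_congr_primePow_iff hL (by lia)]
  refine ⟨fun hI => hI.2.1, fun hI => ⟨hL.1, hI, fun a ha b hb => ?_, fun a ha b hb => ?_⟩⟩
  · obtain ⟨c, hc, habc⟩ :=
      (hL.2 _).1 (add_mem ((hL.2 _).2 ⟨a, ha, rfl⟩) ((hL.2 _).2 ⟨b, hb, rfl⟩))
    exact ⟨c, hc, (h.congr_add_iff (hL.1 a ha) (hL.1 b hb) (hL.1 c hc)).2 habc.symm⟩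
  · obtain ⟨c, hc, habc⟩ := (hL.2 _).1 (I.mul_mem_left (ρ (ofCoeffs₂ a)) ((hL.2 _).2 ⟨b, hb, rfl⟩))
    exact ⟨c, hc, (h.congr_mul_iff ha (hL.1 b hb) (hL.1 c hc)).2 habc.symm⟩

theorem contained_iff (h : M.Realizes ρ) (hL : M.Lists ρ L I) (hL' : M.Lists ρ L' I') :
    M.Contained L L' ↔ I ≤ I' := by
  rw [SetLike.le_def, hL.forall_mem_iff]
  simp only [hL'.2]
  refine forall₂_congr fun a ha => exists_congr fun b => and_congr_right fun hb => ?_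
  rw [h.congr_iff (h.reducible a (hL.1 a ha)) (h.reducible b (hL'.1 b hb)), eq_comm]

theorem containsProduct_iff (h : M.Realizes ρ) (hJ : M.Lists ρ J K) (hL : M.Lists ρ L I)
    (hL' : M.Lists ρ L' I') : M.ContainsProduct J L L' ↔ I * I' ≤ K := by
  simp only [Ideal.mul_le, hL.forall_mem_iff, hL'.forall_mem_iff, hJ.2]
  refine forall₂_congr fun a ha => forall₂_congr fun b hb => exists_congr fun c =>
    and_congr_right fun hc => ?_
  rw [h.congr_mul_iff (hL.1 a ha) (hL'.1 b hb) (hJ.1 c hc), eq_comm]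

theorem forall_exists_congr_prime_mul_iff (h : M.Realizes ρ) (hL : M.Lists ρ L I)
    (hJ : M.Lists ρ J K) : (∀ a ∈ L, ∃ b ∈ J, M.Congr (mulCoeffs₂ (M.primePow 1) a) b) ↔
      Ideal.span {ρ (C (ofCoeffs M.prime))} * I ≤ K := by
  simp only [Ideal.span_singleton_mul_le_iff, hL.forall_mem_iff, hJ.2]
  refine forall₂_congr fun a ha => exists_congr fun b => and_congr_right fun hb => ?_
  rw [h.congr_primePow_mul_iff (hL.1 a ha) (hJ.1 b hb) (by lia), pow_one, eq_comm]

theorem isProduct_iff (h : M.Realizes ρ)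
    (hII' : ρ (C (ofCoeffs M.prime)) ^ M.idealLevel ∈ I * I') (hL : M.Lists ρ L I)
    (hL' : M.Lists ρ L' I') : M.IsProduct J L L' ↔ M.Lists ρ J (I * I') := by
  constructor
  · rintro ⟨hJ, hprod, hmin⟩
    obtain ⟨K, hJK⟩ := h.exists_lists_of_isIdeal hJ
    obtain ⟨J', hJ', hJ'I⟩ := h.exists_lists (I * I')
    have hle : K ≤ I * I' := (h.contained_iff hJK hJ'I).1 <| hmin J' hJ'
      ((h.isIdeal_iff hJ'I).2 hII') ((h.containsProduct_iff hJ'I hL hL').2 le_rfl)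
    rwa [← hle.antisymm ((h.containsProduct_iff hJK hL hL').1 hprod)]
  · refine fun hJ => ⟨(h.isIdeal_iff hJ).2 hII', (h.containsProduct_iff hJ hL hL').2 le_rfl,
      fun J' _ hJ' hprod => ?_⟩
    obtain ⟨K, hJK⟩ := h.exists_lists_of_isIdeal hJ'
    exact (h.contained_iff hJ hJK).2 ((h.containsProduct_iff hJK hL hL').1 hprod)

theorem forall_exists_congr_mul_iff (h : M.Realizes ρ) (hL : M.Lists ρ L I)
    (hL' : M.Lists ρ L' I') (ha : a ∈ M.elems) (hi : i < M.precision) :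
    (∀ b ∈ L, ∃ c ∈ L', M.Congr (mulCoeffs₂ a b) (mulCoeffs₂ (M.primePow i) c)) ↔
      ∀ s ∈ I, ∃ s' ∈ I', ρ (ofCoeffs₂ a) * s = ρ (C (ofCoeffs M.prime)) ^ i * s' := by
  simp only [hL.forall_mem_iff, hL'.exists_mem_iff]
  exact forall₂_congr fun b hb => exists_congr fun c => and_congr_right fun hc =>
    h.congr_mul_primePow_mul_iff ha (hL.1 b hb) (hL'.1 c hc) hi

theorem equivalent_iff (h : M.Realizes ρ) (hL : M.Lists ρ L I) (hL' : M.Lists ρ L' I') :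
    M.Equivalent L L' ↔ ∃ y z, y * z = ρ (C (ofCoeffs M.prime)) ^ (2 * M.idealLevel) ∧
      (∀ s ∈ I, ∃ s' ∈ I', y * s = ρ (C (ofCoeffs M.prime)) ^ M.idealLevel * s') ∧
      ∀ s' ∈ I', ∃ s ∈ I, z * s' = ρ (C (ofCoeffs M.prime)) ^ M.idealLevel * s := by
  rw [h.exists_iff]
  refine exists_congr fun y => and_congr_right fun hy => ?_
  rw [h.exists_iff]
  refine exists_congr fun z => and_congr_right fun hz => and_congr ?_ (and_congr ?_ ?_)
  · exact h.congr_mul_primePow_iff hy hz (by lia)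
  · exact h.forall_exists_congr_mul_iff hL hL' hy (i := M.idealLevel) (by lia)
  · exact h.forall_exists_congr_mul_iff hL' hL hz (i := M.idealLevel) (by lia)

end Realizes
end ModelData

end Models

section Certification

variable {k : Type*} [Field k] {S : Type*} [CommRing S]

namespace ModelData

/-- The ideal generated by the power `P ^ N` in the ring `S`, into which `k[T][x]` is mapped by
`σ`. -/
abbrev modulus (M : ModelData k) (σ : k[X][X] →+* S) : Ideal S :=
  Ideal.span {σ (C (ofCoeffs M.prime)) ^ M.precision}

/-- The ring `S` is finitely complete at the image of `P` under `σ`, and `M` is a finite model of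
`S / P ^ N`. -/
structure Presents (M : ModelData k) (σ : k[X][X] →+* S) : Prop where
  finitelyComplete : FinitelyComplete (σ (C (ofCoeffs M.prime)))
  realizes : M.Realizes ((Ideal.Quotient.mk (M.modulus σ)).comp σ)

/-- The ideal `I` of `S` contains `P ^ m`, and the members of the list `L` represent the elements
of `I / P ^ N`. -/
def ListsIdeal (M : ModelData k) (σ : k[X][X] →+* S) (L : List (List (List k))) (I : Ideal S) :
    Prop :=
  σ (C (ofCoeffs M.prime)) ^ M.idealLevel ∈ I ∧
    M.Lists ((Ideal.Quotient.mk (M.modulus σ)).comp σ) L (I.map (Ideal.Quotient.mk (M.modulus σ)))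

variable {M : ModelData k} {σ : k[X][X] →+* S} {J L L' : List (List (List k))} {I I' K : Ideal S}

theorem modulus_le {m : ℕ} (hI : σ (C (ofCoeffs M.prime)) ^ m ∈ I) (hm : m ≤ M.precision) :
    M.modulus σ ≤ I :=
  (Ideal.span_singleton_le_iff_mem I).2 (I.pow_mem_of_pow_mem hI hm)

theorem map_mk_modulus_le_iff {m : ℕ} (hI' : σ (C (ofCoeffs M.prime)) ^ m ∈ I')
    (hm : m ≤ M.precision) :
    I.map (Ideal.Quotient.mk (M.modulus σ)) ≤ I'.map (Ideal.Quotient.mk (M.modulus σ)) ↔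
      I ≤ I' := by
  rw [Ideal.map_le_iff_le_comap, Ideal.comap_map_quotientMk, sup_eq_right.2 (modulus_le hI' hm)]

namespace ListsIdeal

theorem pow_mem_map_iff (hL : M.ListsIdeal σ L I) (i : ℕ) :
    (Ideal.Quotient.mk (M.modulus σ)).comp σ (C (ofCoeffs M.prime)) ^ i ∈
      I.map (Ideal.Quotient.mk (M.modulus σ)) ↔ σ (C (ofCoeffs M.prime)) ^ i ∈ I := by
  rw [RingHom.comp_apply, ← map_pow, Ideal.mem_quotient_iff_mem (modulus_le hL.1 (by lia))]

end ListsIdeal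

namespace Presents

theorem listsIdeal_elems (h : M.Presents σ) : M.ListsIdeal σ M.elems ⊤ :=
  ⟨Submodule.mem_top, by simpa only [Ideal.map_top] using h.realizes.lists_elems⟩

theorem exists_listsIdeal (h : M.Presents σ) (hI : σ (C (ofCoeffs M.prime)) ^ M.idealLevel ∈ I) :
    ∃ L ∈ M.elems.sublists, M.ListsIdeal σ L I :=
  (h.realizes.exists_lists _).imp fun _ hL => ⟨hL.1, hI, hL.2⟩

theorem isIdeal (h : M.Presents σ) (hL : M.ListsIdeal σ L I) : M.IsIdeal L :=
  (h.realizes.isIdeal_iff hL.2).2 ((hL.pow_mem_map_iff _).2 hL.1)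

theorem exists_listsIdeal_of_isIdeal (h : M.Presents σ) (hL : M.IsIdeal L) :
    ∃ I, M.ListsIdeal σ L I := by
  obtain ⟨I, hI⟩ := h.realizes.exists_lists_of_isIdeal hL
  refine ⟨I.comap (Ideal.Quotient.mk _), ?_, ?_⟩
  · simpa using (h.realizes.isIdeal_iff hI).1 hL
  · rwa [Ideal.map_comap_of_surjective _ Ideal.Quotient.mk_surjective]

theorem exists_congr_primePow_level_iff (h : M.Presents σ) (hL : M.ListsIdeal σ L I) :
    (∃ a ∈ L, M.Congr a (M.primePow M.level)) ↔ σ (C (ofCoeffs M.prime)) ^ M.level ∈ I :=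
  (h.realizes.exists_congr_primePow_iff hL.2 (by lia)).trans (hL.pow_mem_map_iff _)

theorem contained_iff (h : M.Presents σ) (hL : M.ListsIdeal σ L I) (hL' : M.ListsIdeal σ L' I') :
    M.Contained L L' ↔ I ≤ I' :=
  (h.realizes.contained_iff hL.2 hL'.2).trans (map_mk_modulus_le_iff hL'.1 (by lia))

theorem forall_exists_congr_prime_mul_iff (h : M.Presents σ) (hL : M.ListsIdeal σ L I)
    (hJ : M.ListsIdeal σ J K) : (∀ a ∈ L, ∃ b ∈ J, M.Congr (mulCoeffs₂ (M.primePow 1) a) b) ↔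
      Ideal.span {σ (C (ofCoeffs M.prime))} * I ≤ K := by
  rw [h.realizes.forall_exists_congr_prime_mul_iff hL.2 hJ.2, RingHom.comp_apply,
    ← Set.image_singleton, ← Ideal.map_span, ← Ideal.map_mul,
    map_mk_modulus_le_iff hJ.1 (by lia)]

theorem equivalent_iff (h : M.Presents σ) (hL : M.ListsIdeal σ L I) (hL' : M.ListsIdeal σ L' I') :
    M.Equivalent L L' ↔ SameClass I I' :=
  (h.realizes.equivalent_iff hL.2 hL'.2).trans
    (h.finitelyComplete.sameClass_iff_quotient hL.1 hL'.1 (by lia)).symm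

theorem isProduct_iff (h : M.Presents σ)
    (hII' : σ (C (ofCoeffs M.prime)) ^ M.idealLevel ∈ I * I') (hL : M.ListsIdeal σ L I)
    (hL' : M.ListsIdeal σ L' I') : M.IsProduct J L L' ↔ M.ListsIdeal σ J (I * I') := by
  rw [ListsIdeal, and_iff_right hII', Ideal.map_mul]
  refine h.realizes.isProduct_iff ?_ hL.2 hL'.2
  rw [← Ideal.map_mul, RingHom.comp_apply, ← map_pow]
  exact Ideal.mem_map_of_mem _ hII'

theorem span_eq (h : M.Presents σ) (hI : σ (C (ofCoeffs M.prime)) ^ M.level ∈ I)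
    (hL : M.ListsIdeal σ L I) : Ideal.span {s | ∃ a ∈ L, s = σ (ofCoeffs₂ a)} = I := by
  set π := σ (C (ofCoeffs M.prime))
  have exists_dvd_sub : ∀ s ∈ I, ∃ a ∈ L, π ^ M.precision ∣ σ (ofCoeffs₂ a) - s := fun s hs => by
    simpa only [RingHom.comp_apply, Ideal.Quotient.mk_eq_mk_iff_sub_mem,
      Ideal.mem_span_singleton] using (hL.2.2 _).1 (Ideal.mem_map_of_mem _ hs)
  refine le_antisymm (Ideal.span_le.2 ?_) fun s hs => ?_
  · rintro _ ⟨a, ha, rfl⟩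
    rw [SetLike.mem_coe, ← Ideal.mem_quotient_iff_mem (modulus_le hL.1 (by lia))]
    exact (hL.2.2 _).2 ⟨a, ha, rfl⟩
  set I₀ := Ideal.span {s | ∃ a ∈ L, s = σ (ofCoeffs₂ a)}
  have mem_span : ∀ a ∈ L, σ (ofCoeffs₂ a) ∈ I₀ := fun a ha => Ideal.subset_span ⟨a, ha, rfl⟩
  have pow_mem : π ^ M.level ∈ I₀ := by
    obtain ⟨a, ha, c, hc⟩ := exists_dvd_sub _ hI
    have hpow : π ^ M.precision = π ^ M.level * π * π ^ (M.precision - M.level - 1) := by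
      rw [← pow_succ, ← pow_add]
      congr 1
      lia
    have hunit := h.finitelyComplete.isUnit_one_add_mul (π ^ (M.precision - M.level - 1) * c)
    rw [← Ideal.mul_unit_mem_iff_mem _ hunit]
    convert mem_span a ha using 1
    linear_combination -hc - c * hpow
  obtain ⟨a, ha, hsa⟩ := exists_dvd_sub s hs
  rw [← sub_sub_cancel (σ (ofCoeffs₂ a)) s]
  exact sub_mem (mem_span a ha) (I₀.mem_of_dvd ((pow_dvd_pow π (by lia)).trans hsa) pow_mem)

variable {out : List (List (List (List k))) × List (List ℕ)}

theorem exists_listsIdeal_of_certifies (h : M.Presents σ) (hout : M.Certifies out)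
    (hL : L ∈ out.1) : ∃ I, σ (C (ofCoeffs M.prime)) ^ M.level ∈ I ∧ M.ListsIdeal σ L I := by
  obtain ⟨hideal, hlevel⟩ := hout.1 L hL
  obtain ⟨I, hI⟩ := h.exists_listsIdeal_of_isIdeal hideal
  exact ⟨I, (h.exists_congr_primePow_level_iff hI).1 hlevel, hI⟩

section

variable {I : Fin out.1.length → Ideal S}

theorem eq_of_certifies (h : M.Presents σ) (hout : M.Certifies out)
    (hL : ∀ i, M.ListsIdeal σ (out.1.get i) (I i)) (i j : Fin out.1.length)
    (hij : SameClass (I i) (I j)) : i = j := by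
  refine Fin.ext (hout.2.1 i i.2 j j.2 ?_)
  rw [List.getD_eq_get _ _ i, List.getD_eq_get _ _ j]
  exact (h.equivalent_iff (hL i) (hL j)).2 hij

theorem exists_sameClass_of_certifies (h : M.Presents σ) (hout : M.Certifies out)
    (hI : ∀ i, σ (C (ofCoeffs M.prime)) ^ M.level ∈ I i)
    (hL : ∀ i, M.ListsIdeal σ (out.1.get i) (I i)) (J : Ideal S) (m : ℕ)
    (hJ : σ (C (ofCoeffs M.prime)) ^ m ∈ J) : ∃ i, SameClass (I i) J := by
  obtain ⟨-, -, ⟨L₀, hL₀, htop⟩, hclosed, -⟩ := hout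
  rw [← Set.exists_range_iff (p := fun I => SameClass I J)]
  refine exists_sameClass_of_neighbours ?_ ?_ hJ
  · obtain ⟨i, rfl⟩ := List.get_of_mem hL₀
    exact ⟨I i, ⟨i, rfl⟩, (h.equivalent_iff (hL i) h.listsIdeal_elems).1 htop⟩
  · rintro _ ⟨i, rfl⟩ K hK hpK
    have hK' : σ (C (ofCoeffs M.prime)) ^ M.idealLevel ∈ K := by
      refine K.pow_mem_of_pow_mem (m := M.level + 1) (hpK ?_) (by lia)
      rw [pow_succ']
      exact Ideal.mul_mem_mul (Ideal.mem_span_singleton_self _) (hI i)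
    obtain ⟨L, hL_mem, hLK⟩ := h.exists_listsIdeal hK'
    obtain ⟨L', hL', hequiv⟩ := hclosed _ (List.get_mem out.1 i) L hL_mem (h.isIdeal hLK)
      ((h.contained_iff hLK (hL i)).2 hK) ((h.forall_exists_congr_prime_mul_iff (hL i) hLK).2 hpK)
    obtain ⟨j, rfl⟩ := List.get_of_mem hL'
    exact ⟨I j, ⟨j, rfl⟩, (h.equivalent_iff (hL j) hLK).1 hequiv⟩

theorem exists_index_of_certifies (h : M.Presents σ) (hout : M.Certifies out)
    (hI : ∀ i, σ (C (ofCoeffs M.prime)) ^ M.level ∈ I i)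
    (hL : ∀ i, M.ListsIdeal σ (out.1.get i) (I i)) (i j : Fin out.1.length) :
    ∃ m : Fin out.1.length, (∃ row, out.2[(i : ℕ)]? = some row ∧ row[(j : ℕ)]? = some (m : ℕ)) ∧
      SameClass (I i * I j) (I m) := by
  obtain ⟨r, hr, hrow, J, -, hJ, hequiv⟩ := hout.2.2.2.2 i i.2 j j.2
  rw [List.getD_eq_get _ _ i, List.getD_eq_get _ _ j, h.isProduct_iff
    (pow_mem_mul_of_pow_mem (hI i) (hI j) (by lia)) (hL i) (hL j)] at hJ
  rw [List.getD_eq_get _ _ ⟨r, hr⟩, h.equivalent_iff (hL _) hJ] at hequiv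
  refine ⟨⟨r, hr⟩, ⟨out.2.getD i [], ?_, hrow⟩, hequiv.symm⟩
  rcases hi : out.2[(i : ℕ)]? with - | row
  · simp [List.getD_eq_getElem?_getD, hi] at hrow
  · simp [List.getD_eq_getElem?_getD, hi]

end

theorem exists_equiv_of_certifies (h : M.Presents σ) (hout : M.Certifies out) :
    ∃ e : Fin out.1.length ≃ ICM S,
      (∀ i, ∃ hI, classOfIdeal (Ideal.span {s | ∃ a ∈ out.1.get i, s = σ (ofCoeffs₂ a)}) hI =
        e i) ∧
      ∀ i j : Fin out.1.length, ∃ m : Fin out.1.length,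
        (∃ row, out.2[(i : ℕ)]? = some row ∧ row[(j : ℕ)]? = some (m : ℕ)) ∧ e i * e j = e m := by
  choose I hI hL using fun i => h.exists_listsIdeal_of_certifies hout (List.get_mem out.1 i)
  have hreg : ∀ i, ∃ x ∈ I i, x ∈ nonZeroDivisors S := fun i =>
    h.finitelyComplete.exists_mem_nonZeroDivisors (hI i)
  refine ⟨Equiv.ofBijective _ (h.finitelyComplete.bijective_classOfIdeal hreg
    (h.eq_of_certifies hout hL) (h.exists_sameClass_of_certifies hout hI hL)), fun i => ?_,
    fun i j => ?_⟩
  · rw [h.span_eq (hI i) (hL i)]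
    exact ⟨hreg i, rfl⟩
  · obtain ⟨m, hrow, hm⟩ := h.exists_index_of_certifies hout hI hL i j
    refine ⟨m, hrow, (classOfIdeal_mul (hreg i) (hreg j) ?_).trans (classOfIdeal_eq_iff.2 hm)⟩
    exact h.finitelyComplete.exists_mem_nonZeroDivisors
      (pow_mem_mul_of_pow_mem (hI i) (hI j) le_rfl)

theorem certifies_ofFn (h : M.Presents σ) {n : ℕ} {L : Fin n → List (List (List k))}
    {I : Fin n → Ideal S} {r : Fin n → Fin n → Fin n}
    (hI : ∀ i, σ (C (ofCoeffs M.prime)) ^ M.level ∈ I i) (hL : ∀ i, M.ListsIdeal σ (L i) (I i))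
    (hinj : ∀ i j, SameClass (I i) (I j) → i = j)
    (hsurj : ∀ (J : Ideal S) (m : ℕ), σ (C (ofCoeffs M.prime)) ^ m ∈ J → ∃ i, SameClass (I i) J)
    (hr : ∀ i j, SameClass (I (r i j)) (I i * I j)) :
    M.Certifies (List.ofFn L, List.ofFn fun i => List.ofFn fun j => (r i j : ℕ)) := by
  have getD_ofFn : ∀ i : Fin n, (List.ofFn L).getD i [] = L i := fun i => by
    simp [List.getD_eq_getElem?_getD]
  simp only [Certifies, List.forall_mem_ofFn_iff, List.length_ofFn]
  refine ⟨fun i => ⟨h.isIdeal (hL i), (h.exists_congr_primePow_level_iff (hL i)).2 (hI i)⟩,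
    fun i hi j hj hij => ?_, ?_, fun _ J _ hJ _ _ => ?_, fun i hi j hj => ?_⟩
  · lift i to Fin n using hi
    lift j to Fin n using hj
    rw [getD_ofFn, getD_ofFn, h.equivalent_iff (hL i) (hL j)] at hij
    rw [hinj i j hij]
  · obtain ⟨i, hi⟩ := hsurj ⊤ 0 Submodule.mem_top
    exact ⟨L i, List.mem_ofFn.2 ⟨i, rfl⟩, (h.equivalent_iff (hL i) h.listsIdeal_elems).2 hi⟩
  · obtain ⟨K, hK⟩ := h.exists_listsIdeal_of_isIdeal hJ
    obtain ⟨i, hi⟩ := hsurj K _ hK.1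
    exact ⟨L i, List.mem_ofFn.2 ⟨i, rfl⟩, (h.equivalent_iff (hL i) hK).2 hi⟩
  · lift i to Fin n using hi
    lift j to Fin n using hj
    have hmem := pow_mem_mul_of_pow_mem (hI i) (hI j) (by lia : _ ≤ M.idealLevel)
    obtain ⟨J, hJ_mem, hJ⟩ := h.exists_listsIdeal hmem
    refine ⟨r i j, (r i j).2, by simp [List.getD_eq_getElem?_getD], J, hJ_mem, ?_, ?_⟩
    · rwa [getD_ofFn, getD_ofFn, h.isProduct_iff hmem (hL i) (hL j)]
    · rw [getD_ofFn, h.equivalent_iff (hL _) hJ]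
      exact hr i j

theorem exists_certifies (h : M.Presents σ) (hlevel : ∀ (I : Ideal S) (n : ℕ),
    σ (C (ofCoeffs M.prime)) ^ n ∈ I →
      ∃ J, σ (C (ofCoeffs M.prime)) ^ M.level ∈ J ∧ SameClass I J) : ∃ out, M.Certifies out := by
  obtain ⟨n, I, hI, hinj, hsurj⟩ := h.finitelyComplete.exists_representatives hlevel
  choose L _ hL using fun i => h.exists_listsIdeal ((I i).pow_mem_of_pow_mem (hI i) (by lia))
  choose r hr using fun i j => hsurj (I i * I j) _ (pow_mem_mul_of_pow_mem (hI i) (hI j) le_rfl)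
  exact ⟨_, h.certifies_ofFn hI hL hinj hsurj hr⟩

end Presents
end ModelData

end Certification

section Generation

variable {A : Type*} [Semiring A]

theorem subsemiring_eq_top_of_C_C_mem {B : Subsemiring A[X][X]} (hC : ∀ c, C (C c) ∈ B)
    (hT : C X ∈ B) (hX : X ∈ B) : B = ⊤ := by
  have C_mem (a : A[X]) : C a ∈ B := by
    induction a using Polynomial.induction_on' with
    | add a b ha hb => exact C_add (R := A[X]) ▸ add_mem ha hb
    | monomial n c =>
      rw [← C_mul_X_pow_eq_monomial, C_mul, C_pow]
      exact mul_mem (hC c) (pow_mem hT n)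
  refine eq_top_iff.2 fun g _ => ?_
  induction g using Polynomial.induction_on' with
  | add g h hg hh => exact add_mem (hg trivial) (hh trivial)
  | monomial n a =>
    rw [← C_mul_X_pow_eq_monomial]
    exact mul_mem (C_mem a) (pow_mem hX n)

end Generation

section Realization

variable {k : Type*} [Field k]

namespace ModelData

variable {M : ModelData k} {κ : List k} {a e e' : List (List k)}

theorem ReducesTo.of_eq (h : M.ReducesTo a e) (he : ofCoeffs₂ e = ofCoeffs₂ e') :
    M.ReducesTo a e' := by
  obtain ⟨w, hw, hw'⟩ := h
  refine ⟨w, hw, ?_⟩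
  rwa [ofCoeffs₂_addCoeffs₂, ← he, ← ofCoeffs₂_addCoeffs₂]

section

variable {Q : Type*} [CommRing Q] {ρ : k[X][X] →+* Q}

theorem ReducesTo.map_eq (h : M.ReducesTo a e) (hf : ρ (ofCoeffs₂ M.poly) = 0)
    (hP : ρ (C (ofCoeffs M.prime)) ^ M.precision = 0) :
    ρ (ofCoeffs₂ a) = ρ (ofCoeffs₂ e) := by
  obtain ⟨w, -, hw⟩ := h
  simp only [hw, ofCoeffs₂_addCoeffs₂, ofCoeffs₂_mulCoeffs₂, ofCoeffs₂_primePow, map_add, map_mul,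
    map_pow, hf, hP, mul_zero, add_zero]

theorem exists_elem_map_eq (hκ : ∀ c, c ∈ κ) (hM : ∀ a ∈ M.required κ, M.Reducible a)
    (hf : ρ (ofCoeffs₂ M.poly) = 0) (hP : ρ (C (ofCoeffs M.prime)) ^ M.precision = 0)
    (g : k[X][X]) : ∃ e ∈ M.elems, ρ (ofCoeffs₂ e) = ρ g := by
  have exists_eq_of_required : ∀ a ∈ M.required κ, ∃ e ∈ M.elems,
      ρ (ofCoeffs₂ e) = ρ (ofCoeffs₂ a) := fun a ha => by
    obtain ⟨e, he, hae⟩ := hM a ha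
    exact ⟨e, he, (hae.map_eq hf hP).symm⟩
  have const (c : k) : ∃ e ∈ M.elems, ρ (ofCoeffs₂ e) = ρ (C (C c)) := by
    simpa [ofCoeffs₂, ofCoeffs] using exists_eq_of_required [[c]] (by simp [required, hκ c])
  let B : Subsemiring k[X][X] :=
    { carrier := {g | ∃ e ∈ M.elems, ρ (ofCoeffs₂ e) = ρ g}
      zero_mem' := by simpa using const 0
      one_mem' := by simpa using const 1
      add_mem' := by
        rintro g g' ⟨e, he, hg⟩ ⟨e', he', hg'⟩
        simpa [ofCoeffs₂_addCoeffs₂, hg, hg'] using exists_eq_of_required (addCoeffs₂ e e')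
          (by simp only [required, List.mem_append, List.mem_flatMap, List.mem_map]; grind)
      mul_mem' := by
        rintro g g' ⟨e, he, hg⟩ ⟨e', he', hg'⟩
        simpa [ofCoeffs₂_mulCoeffs₂, hg, hg'] using exists_eq_of_required (mulCoeffs₂ e e')
          (by simp only [required, List.mem_append, List.mem_flatMap, List.mem_map]; grind) }
  suffices B = ⊤ from this.ge (Subsemiring.mem_top g)
  refine subsemiring_eq_top_of_C_C_mem const ?_ ?_
  · change ∃ e ∈ M.elems, ρ (ofCoeffs₂ e) = ρ (C X)
    simpa [ofCoeffs₂, ofCoeffs] using exists_eq_of_required [[0, 1]] (by simp [required])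
  · change ∃ e ∈ M.elems, ρ (ofCoeffs₂ e) = ρ X
    simpa [ofCoeffs₂, ofCoeffs] using exists_eq_of_required [[], [1]] (by simp [required])

theorem realizes_of_forall_required (hκ : ∀ c, c ∈ κ) (hM : ∀ a ∈ M.required κ, M.Reducible a)
    (hρ : Function.Surjective ρ) (hf : ρ (ofCoeffs₂ M.poly) = 0)
    (hP : ρ (C (ofCoeffs M.prime)) ^ M.precision = 0)
    (hinj : ∀ e ∈ M.elems, ∀ e' ∈ M.elems, ρ (ofCoeffs₂ e) = ρ (ofCoeffs₂ e') →
      ofCoeffs₂ e = ofCoeffs₂ e') : M.Realizes ρ := by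
  have hexists := exists_elem_map_eq hκ hM hf hP
  simp only [required, List.mem_append, List.mem_flatMap, List.mem_map, List.mem_range] at hM
  refine ⟨fun {a b} ha hb => ⟨fun ⟨e, _, hae, hbe⟩ => ?_, fun hab => ?_⟩, fun s => ?_,
    fun a ha => hM a ?_, fun a ha b hb => hM _ ?_, fun a ha b hb => hM _ ?_,
    fun i hi => hM _ ?_, fun i hi b hb => hM _ ?_⟩
  · rw [hae.map_eq hf hP, hbe.map_eq hf hP]
  · obtain ⟨e, he, hae⟩ := ha
    obtain ⟨e', he', hbe⟩ := hb
    refine ⟨e, he, hae, hbe.of_eq (hinj e' he' e he ?_)⟩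
    rw [← hae.map_eq hf hP, ← hbe.map_eq hf hP, hab]
  · obtain ⟨g, rfl⟩ := hρ s
    exact hexists g
  all_goals grind

end

namespace IsModel

theorem primeDeg_le (hM : M.IsModel κ) : M.primeDeg ≤ (ofCoeffs M.prime).natDegree := by
  refine le_natDegree_of_ne_zero ?_
  rw [coeff_ofCoeffs]
  exact hM.1

theorem polyDeg_le (hM : M.IsModel κ) : M.polyDeg ≤ (ofCoeffs₂ M.poly).natDegree := by
  obtain ⟨c, hc, hc0⟩ := hM.2.1
  refine le_natDegree_of_ne_zero fun h => ?_
  rw [coeff_ofCoeffs₂, ofCoeffs_eq_zero_iff] at h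
  exact hc0 (h c hc)

end IsModel

end ModelData

/-- The map `k[T][x] → R → R_P`, where `R = k[T][x]/(f)`. -/
noncomputable def toCompletedOrder (f : k[X][X]) (P : k[X]) : k[X][X] →+* CompletedOrder f P :=
  (algebraMap (AdjoinRoot f) (CompletedOrder f P)).comp (AdjoinRoot.mk f)

variable {f : k[X][X]} {P : k[X]}

theorem toCompletedOrder_C : toCompletedOrder f P (C P) = completedPrime f P :=
  rfl

theorem toCompletedOrder_self : toCompletedOrder f P f = 0 := by
  rw [toCompletedOrder, RingHom.comp_apply, AdjoinRoot.mk_self, map_zero]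

theorem completedIdeal_map_ofCoeffs₂ (L : List (List (List k))) :
    completedIdeal f P (L.map ofCoeffs₂) =
      Ideal.span {s | ∃ a ∈ L, s = toCompletedOrder f P (ofCoeffs₂ a)} := by
  simp only [completedIdeal, List.mem_map, exists_exists_and_eq_and]
  rfl

theorem exists_completedPrime_pow_dvd_sub (n : ℕ) (s : CompletedOrder f P) :
    ∃ g, completedPrime f P ^ n ∣ s - toCompletedOrder f P g := by
  obtain ⟨r, hr⟩ :=
    adicCompletion_exists_pow_dvd_sub (map_span_singleton_adjoinRoot f P) n s
  obtain ⟨g, rfl⟩ := AdjoinRoot.mk_surjective r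
  exact ⟨g, hr⟩

theorem completedPrime_pow_dvd_toCompletedOrder_iff (n : ℕ) (g : k[X][X]) :
    completedPrime f P ^ n ∣ toCompletedOrder f P g ↔
      algebraMap k[X] (AdjoinRoot f) (P ^ n) ∣ AdjoinRoot.mk f g := by
  rw [map_pow]
  exact adicCompletion_pow_dvd_algebraMap_iff (map_span_singleton_adjoinRoot f P) n _

namespace ModelData

variable {M : ModelData k} {κ : List k}

namespace IsModel

theorem presents [Finite k] (hM : M.IsModel κ) (hκ : ∀ c, c ∈ κ)
    (hf : IsCurve (ofCoeffs₂ M.poly)) (hP : ofCoeffs M.prime ≠ 0) :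
    M.Presents (toCompletedOrder (ofCoeffs₂ M.poly) (ofCoeffs M.prime)) := by
  refine ⟨hf.finitelyComplete hP, realizes_of_forall_required hκ hM.2.2.2 (fun s => ?_) ?_ ?_
    fun e he e' he' h => ?_⟩
  · obtain ⟨s, rfl⟩ := Ideal.Quotient.mk_surjective s
    obtain ⟨g, hg⟩ := exists_completedPrime_pow_dvd_sub M.precision s
    exact ⟨g, (Ideal.Quotient.eq.2 (Ideal.mem_span_singleton.2 hg)).symm⟩
  · rw [RingHom.comp_apply, toCompletedOrder_self, map_zero]
  · rw [RingHom.comp_apply, ← map_pow, Ideal.Quotient.eq_zero_iff_mem]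
    exact Ideal.mem_span_singleton_self _
  · rw [RingHom.comp_apply, RingHom.comp_apply, Ideal.Quotient.eq, ← map_sub,
      Ideal.mem_span_singleton, toCompletedOrder_C, completedPrime_pow_dvd_toCompletedOrder_iff,
      map_sub] at h
    refine hf.eq_of_dvd_sub hM.polyDeg_le ?_ (hM.2.2.1 e he) (hM.2.2.1 e' he') h
    rw [natDegree_pow, mul_comm]
    exact Nat.mul_le_mul_left _ hM.primeDeg_le

theorem describesICM [Finite k] (hM : M.IsModel κ) (hκ : ∀ c, c ∈ κ)
    (hf : IsCurve (ofCoeffs₂ M.poly)) (hP : ofCoeffs M.prime ≠ 0)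
    {out : List (List (List (List k))) × List (List ℕ)} (hout : M.Certifies out) :
    DescribesICM (ofCoeffs₂ M.poly) (ofCoeffs M.prime) out := by
  obtain ⟨e, he, hmul⟩ := (hM.presents hκ hf hP).exists_equiv_of_certifies hout
  refine ⟨e, fun i => ?_, hmul⟩
  obtain ⟨hI, hc⟩ := he i
  rw [Represents, completedIdeal_map_ofCoeffs₂]
  exact ⟨fullOfIdeal _ hI, rfl, hc⟩

end IsModel

theorem exists_mults {f : List (List k)} {Q : List k} (hf : IsCurve (ofCoeffs₂ f))
    (hQ : ofCoeffs Q ≠ 0) (L : List (List (List k))) :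
    ∃ W : List (List (List k) × List (List k)), ∀ a ∈ L, ∃ e,
      IsReduced (ofCoeffs₂ f).natDegree (ofCoeffs Q).natDegree e ∧ ∃ w ∈ W,
        ofCoeffs₂ a = ofCoeffs₂ (addCoeffs₂ e (addCoeffs₂ (mulCoeffs₂ w.1 f)
          (mulCoeffs₂ w.2 [Q]))) := by
  have exists_mult (a : List (List k)) : ∃ w : List (List k) × List (List k), ∃ e,
      IsReduced (ofCoeffs₂ f).natDegree (ofCoeffs Q).natDegree e ∧
        ofCoeffs₂ a = ofCoeffs₂ (addCoeffs₂ e (addCoeffs₂ (mulCoeffs₂ w.1 f)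
          (mulCoeffs₂ w.2 [Q]))) := by
    obtain ⟨e, he, u, v, h⟩ := hf.exists_isReduced hQ (ofCoeffs₂ a)
    obtain ⟨u, rfl⟩ := ofCoeffs₂_surjective u
    obtain ⟨v, rfl⟩ := ofCoeffs₂_surjective v
    refine ⟨(u, v), e, he, ?_⟩
    simp only [h, ofCoeffs₂_addCoeffs₂, ofCoeffs₂_mulCoeffs₂, ofCoeffs₂_singleton, add_assoc]
  choose w e he hw using exists_mult
  exact ⟨L.map w, fun a ha => ⟨e a, he a, w a, List.mem_map_of_mem ha, hw a⟩⟩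

theorem exists_isModel [Finite k] {cf : List (List k)} {cP : List k} (hf : IsCurve (ofCoeffs₂ cf))
    (hP : ofCoeffs cP ≠ 0) (κ : List k) (t : ℕ) :
    ∃ M : ModelData k, M.1 = (cf, cP) ∧ M.level = t ∧ M.IsModel κ := by
  let M (elems mults) : ModelData k :=
    ((cf, cP), (t, (ofCoeffs₂ cf).natDegree, (ofCoeffs cP).natDegree), elems, mults)
  let N := (M [] []).precision
  obtain ⟨elems, helems⟩ : ∃ elems : List (List (List k)), ∀ l, l ∈ elems ↔
      IsReduced (ofCoeffs₂ cf).natDegree ((ofCoeffs cP).natDegree * N) l :=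
    ⟨(finite_isReduced (ofCoeffs₂ cf).natDegree ((ofCoeffs cP).natDegree * N)).toFinset.toList,
      by simp⟩
  have hN : ofCoeffs (powCoeffs cP N) = ofCoeffs cP ^ N := ofCoeffs_powCoeffs _ _
  obtain ⟨W, hW⟩ := exists_mults hf (hN ▸ pow_ne_zero N hP) ((M elems []).required κ)
  simp only [hN, natDegree_pow, mul_comm N, ← helems] at hW
  refine ⟨M elems W, rfl, rfl, ?_, ?_, fun e he => (helems e).1 he, hW⟩
  · change cP.getD (ofCoeffs cP).natDegree 0 ≠ 0
    rw [← coeff_ofCoeffs]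
    exact leadingCoeff_ne_zero.2 hP
  · change ∃ c ∈ cf.getD (ofCoeffs₂ cf).natDegree [], c ≠ 0
    by_contra! h
    rw [← ofCoeffs_eq_zero_iff, ← coeff_ofCoeffs₂] at h
    exact hf.irreducible.ne_zero (leadingCoeff_eq_zero.1 h)

end ModelData

theorem IsCurve.exists_certifies [Finite k] {cf : List (List k)} {cP : List k}
    (hf : IsCurve (ofCoeffs₂ cf)) (hP : Irreducible (ofCoeffs cP)) {κ : List k}
    (hκ : ∀ c, c ∈ κ) :
    ∃ (M : ModelData k) (out : _), M.1 = (cf, cP) ∧ M.IsModel κ ∧ M.Certifies out := by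
  obtain ⟨t, ht⟩ := hf.exists_pow_mem_sameClass hP
  obtain ⟨⟨⟨_, _⟩, M⟩, hM, rfl, hmodel⟩ := ModelData.exists_isModel hf hP.ne_zero κ t
  cases hM
  obtain ⟨out, hout⟩ := (hmodel.presents hκ hf hP.ne_zero).exists_certifies ht
  exact ⟨_, out, rfl, hmodel, hout⟩

end Realization

section Search

theorem exists_partrec_of_primrecPred {α β γ : Type*} [Primcodable α] [Primcodable β]
    [Primcodable γ] {p : α × β × γ → Prop} (hp : PrimrecPred p) :
    ∃ algo : α →. β, Partrec algo ∧ (∀ a, ∀ b ∈ algo a, ∃ c, p (a, b, c)) ∧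
      ∀ a, (∃ b c, p (a, b, c)) → ∃ b, b ∈ algo a := by
  classical
  let F : α → ℕ → Option β := fun a n => (Encodable.decode (α := β × γ) n).bind fun x =>
    if p (a, x) then some x.1 else none
  have hF : Primrec₂ F := by
    refine Primrec.option_bind (Primrec.decode.comp Primrec.snd) ?_
    refine Primrec.ite (c := fun x : (α × ℕ) × β × γ => p (x.1.1, x.2)) ?_ ?_ (Primrec.const _)
    · exact hp.comp (f := fun x : (α × ℕ) × β × γ => (x.1.1, x.2)) (by fun_prop)
    · fun_prop
  refine ⟨fun a => Nat.rfindOpt (F a), Partrec.rfindOpt hF.to_comp, fun a b hb => ?_,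
    fun a ⟨b, c, h⟩ => Part.dom_iff_mem.1 (Nat.rfindOpt_dom.2
      ⟨Encodable.encode (b, c), b, by simp [F, h]⟩)⟩
  obtain ⟨n, hn⟩ := Nat.rfindOpt_spec hb
  obtain ⟨⟨b', c⟩, -, hbc⟩ := Option.bind_eq_some_iff.1 (Option.mem_def.1 hn)
  obtain ⟨hp, rfl⟩ : p (a, b', c) ∧ b' = b := by simpa using hbc
  exact ⟨c, hp⟩

variable {k : Type*} [Field k] [Finite k] [Primcodable k]

theorem primrecPred_isModel_and_certifies (κ : List k) :
    PrimrecPred fun x : (List (List k) × List k) ×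
      (List (List (List (List k))) × List (List ℕ)) × ModelData k =>
      x.2.2.1 = x.1 ∧ x.2.2.IsModel κ ∧ x.2.2.Certifies x.2.1 := by
  refine .and (primrecPred_eq (by fun_prop) (by fun_prop)) (.and ?_ ?_)
  · exact (ModelData.primrecPred_isModel κ).comp (by fun_prop)
  · exact ModelData.primrecPred_certifies.comp (f := fun x : (List (List k) × List k) ×
      (List (List (List (List k))) × List (List ℕ)) × ModelData k => (x.2.2, x.2.1)) (by fun_prop)

end Search

end IdealClasses

/-- Over `A = k[T]` with `k` a finite field, there is one algorithm which, given the coefficients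
of any irreducible `f` in `A[x]` whose leading coefficient is a unit (so that `R = A[x]/(f)` is an
`A`-order) and of any irreducible `P` in `A`, halts and returns the
ideal class monoid of the completion of `R` at `P`. -/
theorem mainTheorem1 {k : Type*} [Field k] [Finite k] [Primcodable k] :
    ∃ algo : List (List k) × List k →. List (List (List (List k))) × List (List ℕ),
      Partrec algo ∧
      ∀ (cf : List (List k)) (cP : List k),
        IsUnit (IdealClasses.ofCoeffs₂ cf).leadingCoeff → Irreducible (IdealClasses.ofCoeffs₂ cf) →
        Irreducible (IdealClasses.ofCoeffs cP) →
        ∃ out ∈ algo (cf, cP),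
          IdealClasses.DescribesICM (IdealClasses.ofCoeffs₂ cf) (IdealClasses.ofCoeffs cP) out := by
  open IdealClasses in
  obtain ⟨κ, hκ⟩ : ∃ κ : List k, ∀ c, c ∈ κ := ⟨Set.finite_univ.toFinset.toList, by simp⟩
  obtain ⟨algo, halgo, hsound, hcomplete⟩ :=
    exists_partrec_of_primrecPred (primrecPred_isModel_and_certifies κ)
  refine ⟨algo, halgo, fun cf cP hlead hirr hP => ?_⟩
  have hf : IsCurve (ofCoeffs₂ cf) := ⟨hlead, hirr⟩
  obtain ⟨M, out, hcert⟩ := hf.exists_certifies hP hκ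
  obtain ⟨out, hout⟩ := hcomplete (cf, cP) ⟨out, M, hcert⟩
  obtain ⟨⟨⟨_, _⟩, M⟩, hM, hmodel, hcert⟩ := hsound _ _ hout
  cases hM
  exact ⟨out, hout, hmodel.describesICM hκ hf hP.ne_zero hcert⟩
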